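/- Let $X\subseteq\mathbb R^n$ be open, let $E:X\to\mathbb R^{n\times n}$ and $F:X\to\mathbb R^n$ be $\mathcal C^\infty$, and let $\Xi=(E,F)$ denote the DAE $E(x)\dot x=F(x)$. Neighbourhoods are open. **Condition (CR).** Let $x_p\in X$ and let $U\subseteq X$ be a neighbourhood of $x_p$. We say that $\Xi$ satisfies (CR) on $U$ if $\operatorname{rank}E(x)=r$ is constant on $U$, and there is a smooth $Q:U\to GL(n,\mathbb R)$ such that $QE=\begin{bmatrix}E_1\\0\end{bmatrix}$ with $E_1(x)\in\mathbb R^{r\times n}$ of full row rank and, writing $QF=\begin{bmatrix}F_1\\F_2\end{bmatrix}$, one has $F_2(x_p)=0$ and both $\operatorname{rank}\mathrm DF_2(x)$ and $\dim\big(E(x)\ker \mathrm DF_2(x)\big)$ are constant on $\{x\in U: F_2(x)=0\}$. **Index.** Put $H(x,x')=E(x)x'-F(x)$ and let $H_k(x,x',w)=0$, $w=(x'',\dots,x^{(k+1)})$, be the $k$-th differential array $H=0,\ \frac{d}{dt}H=0,\dots,\frac{d^k}{dt^k}H=0$ (formal total derivatives). It determines $x'$ near $x_p$ if it has a solution with $x=x_p$,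 and there are a neighbourhood $W\subseteq X$ of $x_p$ and a function $v:W\to\mathbb R^n$ such that every solution $(x,x',w)$ with $x\in W$ has $x'=v(x)$. The index of $\Xi$ around $x_p$ is the least $k\ge 0$ for which this holds. **Involutivity.** The distribution $\ker E$ is involutive around $x_p$ if, on some neighbourhood of $x_p$, the Lie bracket of any two smooth local sections of $\ker E$ is again a section of $\ker E$. **External equivalence.** $\Xi$ is ex-equivalent on an open $V\subseteq X$ to a DAE $\tilde\Xi=(\tilde E,\tilde F)$ on $\tilde X$ if there are a smooth diffeomorphism $\psi$ from $V$ onto an open subset of $\tilde X$ and a smooth $Q:V\to GL(n,\mathbb R)$ such that, for all $x\in V$, $$\tilde E(\psi(x))=Q(x)E(x)\Big(\frac{\partial\psi(x)}{\partial x}\Big)^{-1},\qquad \tilde F(\psi(x))=Q(x)F(x).$$ **Index-1 nonlinear Weierstrass form (INWF).** This is a DAE of the form $$\dot\xi_1=F^*(\xi_1),\qquad 0=\xi_2,$$ on $X_1\times X_2$, where $X_1\subseteq\mathbb R^{r}$ and $X_2\subseteq\mathbb R^{n-r}$ are open, $0\le r<n$, and $F^*:X_1\to\mathbb R^r$ is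 smooth. **Theorem.** Let $x_p\in X$ and suppose that $\Xi$ satisfies (CR) on a neighbourhood $U\subseteq X$ of $x_p$. Then there is a neighbourhood $V\subseteq U$ of $x_p$ on which $\Xi$ is ex-equivalent to an (INWF) if and only if $\Xi$ has index $1$ around $x_p$ and the distribution $\ker E$ is involutive around $x_p$. -/

import Mathlib

open Set Topology
open scoped ContDiff

/-- The coordinate space `ℝᵐ`. -/
abbrev RSpace (m : ℕ) : Type := EuclideanSpace ℝ (Fin m)

/-- A nonlinear DAE `E(x) ẋ = F(x)` with smooth `E`, `F` on an open subset `X` of the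
finite-dimensional space `V` (used with `V = ℝⁿ` and with `V = ℝʳ × ℝˢ`, `r + s = n`, the latter
being `ℝⁿ` with its coordinates split into two blocks).  The square matrix `E(x)` is given as the
linear map it represents.  Values of `E` and `F` outside `X` are irrelevant. -/
structure DAE (V : Type) [NormedAddCommGroup V] [NormedSpace ℝ V] where
  X : Set V
  isOpen_X : IsOpen X
  E : V → V →L[ℝ] V
  F : V → V
  smooth_E : ContDiffOn ℝ ∞ E X
  smooth_F : ContDiffOn ℝ ∞ F X

namespace DAE

section General

variable {V V' : Type} [NormedAddCommGroup V] [NormedSpace ℝ V]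
  [NormedAddCommGroup V'] [NormedSpace ℝ V']

/-- A jet `p = (p 0, p 1, p 2, …)` stands for `(x, x', x'', …)`.  The total time derivative of a
function `G` of the jet is the derivative of `G` at `p` in the direction `(x', x'', x''', …)`, that
is `∑ᵢ (∂G/∂x⁽ⁱ⁾) x⁽ⁱ⁺¹⁾` for a smooth function of finitely many of the `x⁽ⁱ⁾`. -/
noncomputable def totalDeriv (G : (ℕ → V) → V) (p : ℕ → V) : V :=
  lineDeriv ℝ G p (fun i => p (i + 1))

/-- `H(x, x') = E(x) x' - F(x)` as a function of the jet. -/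
def residual (Ξ : DAE V) (p : ℕ → V) : V :=
  Ξ.E (p 0) (p 1) - Ξ.F (p 0)

/-- The `j`-th block `dʲH/dtʲ` of the differential array; it depends on `p 0, …, p (j + 1)` only. -/
noncomputable def arrayBlock (Ξ : DAE V) (j : ℕ) : (ℕ → V) → V :=
  totalDeriv^[j] Ξ.residual

/-- The jet `p = (x, x', w)` solves the `k`-th order differential array `H_k(x, x', w) = 0`. -/
def SolvesArray (Ξ : DAE V) (k : ℕ) (p : ℕ → V) : Prop :=
  ∀ j ≤ k, Ξ.arrayBlock j p = 0

/-- Near `xp`, the `k`-th order differential array uniquely determines `x'` as a function `v` of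
`x`: it can be solved at `x = xp`, and each of its solutions with `x` near `xp` has `x' = v(x)`. -/
def ArrayDetermines (Ξ : DAE V) (xp : V) (k : ℕ) : Prop :=
  (∃ p : ℕ → V, p 0 = xp ∧ Ξ.SolvesArray k p) ∧
  ∃ W : Set V, IsOpen W ∧ xp ∈ W ∧ W ⊆ Ξ.X ∧
    ∃ v : V → V, ∀ p : ℕ → V, p 0 ∈ W → Ξ.SolvesArray k p → p 1 = v (p 0)

/-- The DAE has (differentiation) index `k` around `xp`. -/
def HasIndex (Ξ : DAE V) (xp : V) (k : ℕ) : Prop :=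
  IsLeast {k : ℕ | Ξ.ArrayDetermines xp k} k

/-- The distribution `ker E` is involutive on the open set `W`: the Lie bracket of any two smooth
local sections over an open subset of `W` is again a section. -/
def KerInvolutiveOn (Ξ : DAE V) (W : Set V) : Prop :=
  ∀ W' : Set V, IsOpen W' → W' ⊆ W → ∀ g h : V → V,
    ContDiffOn ℝ ∞ g W' → ContDiffOn ℝ ∞ h W' →
    (∀ x ∈ W', Ξ.E x (g x) = 0) → (∀ x ∈ W', Ξ.E x (h x) = 0) →
    ∀ x ∈ W', Ξ.E x (VectorField.lieBracket ℝ g h x) = 0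

/-- The distribution `ker E` is involutive around `xp`. -/
def KerInvolutiveAt (Ξ : DAE V) (xp : V) : Prop :=
  ∃ W : Set V, IsOpen W ∧ xp ∈ W ∧ W ⊆ Ξ.X ∧ Ξ.KerInvolutiveOn W

/-- `Ξ` is, on the open set `U`, externally equivalent to `Ξ'`: there are a diffeomorphism `ψ` from
`U` onto an open subset of the domain of `Ξ'` and a smooth `Q` on `U` with invertible values with
`E'(ψ(x)) = Q(x) E(x) (∂ψ(x)/∂x)⁻¹` and `F'(ψ(x)) = Q(x) F(x)`. -/
def ExEquivalentOn (Ξ : DAE V) (Ξ' : DAE V') (U : Set V) : Prop :=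
  U ⊆ Ξ.X ∧
  ∃ (ψ : OpenPartialHomeomorph V V') (Q : V → V →L[ℝ] V'),
    ψ.source = U ∧ ψ.target ⊆ Ξ'.X ∧
    ContDiffOn ℝ ∞ ψ ψ.source ∧ ContDiffOn ℝ ∞ ψ.symm ψ.target ∧
    ContDiffOn ℝ ∞ Q U ∧ (∀ x ∈ U, (Q x).IsInvertible) ∧
    ∀ x ∈ U,
      Ξ'.E (ψ x) = (Q x).comp ((Ξ.E x).comp (fderiv ℝ ψ x).inverse) ∧
      Ξ'.F (ψ x) = Q x (Ξ.F x)

end General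

/-- The index-1 nonlinear Weierstrass form `ξ₁' = F*(ξ₁)`, `0 = ξ₂` on `X₁ × X₂ ⊆ ℝʳ × ℝˢ`. There
is at least one algebraic equation: `0 < s`. -/
def IsINWF {r s : ℕ} (Ξ : DAE (RSpace r × RSpace s)) : Prop :=
  0 < s ∧
  ∃ (X₁ : Set (RSpace r)) (X₂ : Set (RSpace s)) (Fs : RSpace r → RSpace r),
    IsOpen X₁ ∧ IsOpen X₂ ∧ ContDiffOn ℝ ∞ Fs X₁ ∧ Ξ.X = X₁ ×ˢ X₂ ∧
    ∀ ξ ∈ Ξ.X, (∀ v, Ξ.E ξ v = (v.1, 0)) ∧ Ξ.F ξ = (Fs ξ.1, ξ.2)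

section ConstantRank

variable {n r s : ℕ}

/-- `Q : U → GL(n, ℝ)` is smooth and puts `E` into the form `Q E = (E₁, 0)` with `E₁(x)` of full row
rank `r` (as a map onto `ℝʳ`). -/
def IsRowCompression (Ξ : DAE (RSpace n)) (U : Set (RSpace n))
    (Q : RSpace n → RSpace n →L[ℝ] RSpace r × RSpace s) : Prop :=
  ContDiffOn ℝ ∞ Q U ∧ ∀ x ∈ U, (Q x).IsInvertible ∧
    (∀ v, (Q x (Ξ.E x v)).2 = 0) ∧
    Function.Surjective (fun v => (Q x (Ξ.E x v)).1)

/-- The second block `F₂` of `Q F = (F₁, F₂)`. -/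
def algebraicPart (Ξ : DAE (RSpace n))
    (Q : RSpace n → RSpace n →L[ℝ] RSpace r × RSpace s) (x : RSpace n) : RSpace s :=
  (Q x (Ξ.F x)).2

/-- The point `xp` satisfies the constraint `F₂(xp) = 0`, and the constant rank condition holds on
the open neighbourhood `U` of `xp`: `rk E` is constant on `U`, and `rk DF₂` and `rk (E ker DF₂)` are
constant on `{x ∈ U | F₂(x) = 0}`. -/
def ConstantRank (Ξ : DAE (RSpace n)) (xp : RSpace n) (U : Set (RSpace n)) : Prop :=
  IsOpen U ∧ xp ∈ U ∧ U ⊆ Ξ.X ∧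
  ∃ (r s : ℕ), r + s = n ∧
    (∀ x ∈ U, Module.finrank ℝ (Ξ.E x).range = r) ∧
    ∃ Q : RSpace n → RSpace n →L[ℝ] RSpace r × RSpace s,
      Ξ.IsRowCompression U Q ∧
      Ξ.algebraicPart Q xp = 0 ∧
      (∃ a : ℕ, ∀ x ∈ U, Ξ.algebraicPart Q x = 0 →
        Module.finrank ℝ (fderiv ℝ (Ξ.algebraicPart Q) x).range = a) ∧
      (∃ b : ℕ, ∀ x ∈ U, Ξ.algebraicPart Q x = 0 →
        Module.finrank ℝ
          (Submodule.map (Ξ.E x).toLinearMap (fderiv ℝ (Ξ.algebraicPart Q) x).ker) = b)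

end ConstantRank

end DAE

/-! Write `Q E = (E₁, 0)` and `Q F = (F₁, F₂)`. The first order array is solvable at `(x, x')`
exactly when `E x' = F` and `DF₂ x' = 0`. So index one means that constraints exist and that the
square operator `M = (E₁, DF₂)` is invertible at `xp` (`hasIndex_one_iff`). This criterion applies
to any row compression with `F₂(xp) = 0`. An equivalence with a normal form through `ψ` supplies one
with `M = Dψ`; hence the index is one, and `ker E`, being the kernel of the differential of `ψ₁`, is
involutive.

Conversely, Frobenius' theorem (`exists_fderiv_eq_zero_of_involutive`) yields `φ` with `Dφ(xp) =
E₁(xp)` and `Dφ = 0` on `ker E`. Then `ψ = (φ, F₂)` has derivative `M(xp)` at `xp` and is a local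
diffeomorphism, while `Dψ M⁻¹ Q` turns `E` into `(Dφ, 0)` and keeps `F₂` as second block. In the
coordinates `ψ` the system reads `ξ₁' = f(ξ)`, `0 = ξ₂`. Hadamard's lemma gives `f(ξ₁, ξ₂) - f(ξ₁,
0) = B ξ₂`, and subtracting `B` times the constraint removes `ξ₂` from `f`.

The core of Frobenius' theorem (`Frobenius.exists_submersion`) follows the leaf through `(y, z)`
along the ray from `z` to `0` and records where it lands. The ray equation is solved by the inverse
function theorem on `C([0, 1], E) × F`, which also gives smooth dependence on `(y, z)`; this rests
on the smoothness of superposition operators. -/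

/-! ### Superposition operators on spaces of continuous functions -/

section Superposition

variable {K E F : Type} [TopologicalSpace K] [CompactSpace K]
  [NormedAddCommGroup E] [NormedSpace ℝ E] [NormedAddCommGroup F] [NormedSpace ℝ F]

/-- Pointwise application of a continuous family of operators to a continuous function. -/
noncomputable def ContinuousMap.pointwiseApply (K E F : Type) [TopologicalSpace K] [CompactSpace K]
    [NormedAddCommGroup E] [NormedSpace ℝ E] [NormedAddCommGroup F] [NormedSpace ℝ F] :
    C(K, E →L[ℝ] F) →L[ℝ] C(K, E) →L[ℝ] C(K, F) :=
  LinearMap.mkContinuous₂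
    (LinearMap.mk₂ ℝ (fun (A : C(K, E →L[ℝ] F)) (y : C(K, E)) =>
        (⟨fun t => A t (y t), by fun_prop⟩ : C(K, F)))
      (fun _ _ _ => by ext; simp) (fun _ _ _ => by ext; simp)
      (fun _ _ _ => by ext; simp) (fun _ _ _ => by ext; simp)) 1
    (fun A y => by
      rw [one_mul]
      refine (ContinuousMap.norm_le _ (mul_nonneg (norm_nonneg A) (norm_nonneg y))).2 fun t => ?_
      exact (A t).le_of_opNorm_le_of_le (A.norm_coe_le_norm t) (y.norm_coe_le_norm t))

@[simp] lemma ContinuousMap.pointwiseApply_apply (A : C(K, E →L[ℝ] F)) (y : C(K, E)) (t : K) :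
    ContinuousMap.pointwiseApply K E F A y t = A t (y t) := rfl

lemma ContinuousMap.hasFDerivAt_comp_left (g : C(E, F)) (g' : C(E, E →L[ℝ] F))
    (hg : ∀ x, HasFDerivAt g (g' x) x) (y : C(K, E)) :
    HasFDerivAt (fun y : C(K, E) => g.comp y)
      (ContinuousMap.pointwiseApply K E F (g'.comp y)) y := by
  rw [hasFDerivAt_iff_isLittleO_nhds_zero, Asymptotics.isLittleO_iff]
  intro ε hε
  -- The range of `y` is compact, so the tube lemma provides a single `δ` valid at all points `y t`.
  have hunif : ∀ᶠ p : E × E in 𝓝ˢ (range y ×ˢ {(0 : E)}),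
      ‖g' (p.1 + p.2) - g' p.1‖ < ε := by
    have hcont : Continuous fun p : E × E => ‖g' (p.1 + p.2) - g' p.1‖ := by fun_prop
    refine (isOpen_lt hcont continuous_const).mem_nhdsSet.2 ?_
    rintro ⟨a, b⟩ ⟨-, hb⟩
    obtain rfl : b = 0 := hb
    simpa using hε
  rw [(isCompact_range y.continuous).nhdsSet_prod_eq isCompact_singleton,
    nhdsSet_singleton, Filter.eventually_prod_iff] at hunif
  obtain ⟨pa, hpa, pb, hpb, hab⟩ := hunif
  obtain ⟨δ, hδ, hball⟩ := Metric.eventually_nhds_iff_ball.1 hpb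
  filter_upwards [Metric.ball_mem_nhds (0 : C(K, E)) hδ] with h hh
  refine (ContinuousMap.norm_le _ (by positivity)).2 fun t => ?_
  have hht : ‖h t‖ < δ := (h.norm_coe_le_norm t).trans_lt (by simpa using hh)
  have hy : pa (y t) := hpa.self_of_nhdsSet _ (mem_range_self t)
  have key := (convex_ball (y t) δ).norm_image_sub_le_of_norm_hasFDerivWithin_le'
    (f := g) (f' := fun x => g' x) (φ := g' (y t)) (C := ε) (x := y t) (y := y t + h t)
    (fun x _ => (hg x).hasFDerivWithinAt)
    (fun x hx => by
      have := hab hy (hball (x - y t) (by simpa [dist_eq_norm] using hx))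
      simpa using this.le)
    (Metric.mem_ball_self hδ) (by simpa [dist_eq_norm] using hht)
  simp only [add_sub_cancel_left] at key
  exact key.trans (mul_le_mul_of_nonneg_left (h.norm_coe_le_norm t) hε.le)

/-- The superposition operator `y ↦ g ∘ y` on a space of continuous functions is smooth. -/
lemma ContinuousMap.contDiff_comp_left (n : ℕ) : ∀ {F : Type} [NormedAddCommGroup F]
    [NormedSpace ℝ F] (g : C(E, F)), ContDiff ℝ n g →
      ContDiff ℝ n (fun y : C(K, E) => g.comp y) := by
  induction n with
  | zero =>
    intro F _ _ g _
    exact contDiff_zero.2 (ContinuousMap.continuous_postcomp g)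
  | succ n ih =>
    intro F _ _ g hg
    push_cast at hg ⊢
    rw [contDiff_succ_iff_fderiv] at hg
    -- The derivative is again a superposition operator, now with values in `E →L[ℝ] F`; hence the
    -- induction must range over all target spaces.
    let g' : C(E, E →L[ℝ] F) := ⟨fderiv ℝ g, hg.2.2.continuous⟩
    refine contDiff_succ_iff_hasFDerivAt (n := (n : ℕ)).2 ⟨_, ?_, fun y =>
      ContinuousMap.hasFDerivAt_comp_left g g' (fun x => (hg.1 x).hasFDerivAt) y⟩
    exact (ContinuousMap.pointwiseApply K E F).contDiff.comp (ih g' hg.2.2)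

lemma ContinuousMap.contDiff_infty_comp_left (g : C(E, F)) (hg : ContDiff ℝ ∞ g) :
    ContDiff ℝ ∞ (fun y : C(K, E) => g.comp y) :=
  contDiff_infty.2 fun n => ContinuousMap.contDiff_comp_left n g (contDiff_infty.1 hg n)

end Superposition

/-! ### Integration on the unit interval, based at `1` -/

section Integration

open unitInterval

/-- The operator `f ↦ (t ↦ ∫₁ᵗ f)` on `C([0, 1], E)`. -/
noncomputable def integrateFromOne (E : Type) [NormedAddCommGroup E] [NormedSpace ℝ E] :
    C(I, E) →L[ℝ] C(I, E) :=
  LinearMap.mkContinuous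
    { toFun := fun f => ⟨fun t => ∫ τ in (1 : ℝ)..t, f (projIcc 0 1 zero_le_one τ), by
        have hf : Continuous fun τ => f (projIcc 0 1 zero_le_one τ) :=
          f.continuous.comp continuous_projIcc
        exact (intervalIntegral.continuous_primitive
          (fun a b => hf.intervalIntegrable a b) 1).comp continuous_subtype_val⟩
      map_add' := fun f g => by
        ext t
        exact intervalIntegral.integral_add
          ((f.continuous.comp continuous_projIcc).intervalIntegrable _ _)
          ((g.continuous.comp continuous_projIcc).intervalIntegrable _ _)
      map_smul' := fun c f => by
        ext t
        exact intervalIntegral.integral_smul c _ } 1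
    (fun f => by
      rw [one_mul]
      refine (ContinuousMap.norm_le _ (norm_nonneg f)).2 fun t => ?_
      refine (intervalIntegral.norm_integral_le_of_norm_le_const
        fun τ _ => f.norm_coe_le_norm _).trans ?_
      refine mul_le_of_le_one_right (norm_nonneg f) ?_
      rw [abs_le]
      constructor <;> linarith [t.2.1, t.2.2])

variable {E : Type} [NormedAddCommGroup E] [NormedSpace ℝ E]

lemma integrateFromOne_apply (f : C(I, E)) (t : I) :
    integrateFromOne E f t = ∫ τ in (1 : ℝ)..t, f (projIcc 0 1 zero_le_one τ) := rfl

lemma hasDerivAt_integral_projIcc [CompleteSpace E] (f : C(I, E)) (t : ℝ) :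
    HasDerivAt (fun t => ∫ τ in (1 : ℝ)..t, f (projIcc 0 1 zero_le_one τ))
      (f (projIcc 0 1 zero_le_one t)) t :=
  intervalIntegral.integral_hasDerivAt_right
    ((f.continuous.comp continuous_projIcc).intervalIntegrable _ _)
    ((f.continuous.comp continuous_projIcc).stronglyMeasurableAtFilter _ _)
    (f.continuous.comp continuous_projIcc).continuousAt

lemma integrateFromOne_eq_sub [CompleteSpace E] (f : C(I, E)) (m : ℝ → E)
    (hm : ∀ t : I, HasDerivAt m (f t) t) (t : I) :
    integrateFromOne E f t = m t - m 1 := by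
  rw [integrateFromOne_apply]
  refine intervalIntegral.integral_eq_sub_of_hasDerivAt (fun τ hτ => ?_)
    ((f.continuous.comp continuous_projIcc).intervalIntegrable _ _)
  have hτ' : τ ∈ Icc (0 : ℝ) 1 := by
    rw [uIcc_of_ge t.2.2] at hτ
    exact ⟨t.2.1.trans hτ.1, hτ.2⟩
  rw [projIcc_of_mem _ hτ']
  exact hm ⟨τ, hτ'⟩

end Integration

/-! ### Local diffeomorphisms and smooth extension -/

section LocalCalculus

variable {E F : Type} [NormedAddCommGroup E] [NormedSpace ℝ E]
  [NormedAddCommGroup F] [NormedSpace ℝ F]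

/-- Inverse function theorem: a smooth map with invertible derivative at `a` is a diffeomorphism
from an open neighbourhood of `a` to an open set. -/
lemma exists_openPartialHomeomorph_contDiffOn [CompleteSpace E] {f : E → F} {U : Set E} {a : E}
    (hU : IsOpen U) (ha : a ∈ U) (hf : ContDiffOn ℝ ∞ f U) (hf' : (fderiv ℝ f a).IsInvertible) :
    ∃ e : OpenPartialHomeomorph E F, (e : E → F) = f ∧ a ∈ e.source ∧ e.source ⊆ U ∧
      ContDiffOn ℝ ∞ e.symm e.target ∧ ∀ x ∈ e.source, (fderiv ℝ f x).IsInvertible := by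
  obtain ⟨f', hf'⟩ := hf'
  have hfa : ContDiffAt ℝ ∞ f a := hf.contDiffAt (hU.mem_nhds ha)
  have hd : HasFDerivAt f (f' : E →L[ℝ] F) a := by
    rw [hf']
    exact (hfa.differentiableAt (by simp)).hasFDerivAt
  let e₀ := hfa.toOpenPartialHomeomorph f hd (by simp)
  have hcont : ContinuousOn (fderiv ℝ f) U := hf.continuousOn_fderiv_of_isOpen hU (by simp)
  -- Invertibility of the derivative is an open condition; restricting to it makes the inverse
  -- smooth on its whole domain.
  have hO : IsOpen (U ∩ fderiv ℝ f ⁻¹' range ((↑) : (E ≃L[ℝ] F) → E →L[ℝ] F)) :=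
    hcont.isOpen_inter_preimage hU ContinuousLinearEquiv.isOpen
  refine ⟨e₀.restrOpen _ hO, rfl, ⟨hfa.mem_toOpenPartialHomeomorph_source hd (by simp), ha, f', hf'⟩,
    fun x hx => hx.2.1, fun z hz => ?_, fun x hx => hx.2.2⟩
  have hx := (e₀.restrOpen _ hO).map_target hz
  obtain ⟨g', hg'⟩ := hx.2.2
  have hfx := hf.contDiffAt (hU.mem_nhds hx.2.1)
  refine ((e₀.restrOpen _ hO).contDiffAt_symm (f₀' := g') hz ?_ hfx).contDiffWithinAt
  rw [hg']
  exact (hfx.differentiableAt (by simp)).hasFDerivAt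

/-- A function smooth near `a` agrees near `a` with a globally smooth one. -/
lemma exists_contDiff_eventuallyEq [FiniteDimensional ℝ E] {f : E → F} {U : Set E} {a : E}
    (hU : IsOpen U) (ha : a ∈ U) (hf : ContDiffOn ℝ ∞ f U) :
    ∃ g : E → F, ContDiff ℝ ∞ g ∧ g =ᶠ[𝓝 a] f := by
  obtain ⟨ε, hε, hball⟩ := Metric.nhds_basis_closedBall.mem_iff.1 (hU.mem_nhds ha)
  let χ : ContDiffBump a := ⟨ε / 2, ε, by positivity, by linarith⟩
  refine ⟨fun x => χ x • f x, contDiff_iff_contDiffAt.2 fun x => ?_, ?_⟩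
  · by_cases hx : x ∈ U
    · exact χ.contDiff.contDiffAt.smul (hf.contDiffAt (hU.mem_nhds hx))
    · have hx' : x ∉ tsupport χ := fun h => hx (hball (χ.tsupport_eq ▸ h))
      refine contDiffAt_const (c := (0 : F)) |>.congr_of_eventuallyEq ?_
      filter_upwards [(isClosed_tsupport χ).isOpen_compl.mem_nhds hx'] with y hy
      simp [image_eq_zero_of_notMem_tsupport hy]
  · filter_upwards [χ.eventuallyEq_one] with y hy
    simp [hy]

end LocalCalculus

/-! ### Hadamard's lemma -/

section Hadamard

open unitInterval

variable {E F G : Type} [NormedAddCommGroup E] [NormedSpace ℝ E]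
  [NormedAddCommGroup F] [NormedSpace ℝ F] [NormedAddCommGroup G] [NormedSpace ℝ G]

/-- The pair `(x, z)` is sent to the segment `t ↦ (x, t z)`. -/
noncomputable def segmentMap (E F : Type) [NormedAddCommGroup E] [NormedSpace ℝ E]
    [NormedAddCommGroup F] [NormedSpace ℝ F] : E × F →L[ℝ] C(I, E × F) :=
  LinearMap.mkContinuous
    { toFun := fun p => ⟨fun t => (p.1, (t : ℝ) • p.2), by fun_prop⟩
      map_add' := fun p q => by ext t <;> simp
      map_smul' := fun c p => by
        ext t
        · rfl
        · exact smul_comm _ _ _ } 1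
    (fun p => by
      rw [one_mul]
      refine (ContinuousMap.norm_le _ (norm_nonneg p)).2 fun t => ?_
      refine max_le (norm_fst_le p) ((norm_smul_le (t : ℝ) p.2).trans ?_)
      rw [Real.norm_eq_abs, abs_of_nonneg t.2.1]
      exact (mul_le_of_le_one_left (norm_nonneg _) t.2.2).trans (norm_snd_le p))

/-- Hadamard's lemma with parameters. -/
lemma exists_contDiff_hadamard [CompleteSpace G] (f : E × F → G) (hf : ContDiff ℝ ∞ f) :
    ∃ B : E × F → F →L[ℝ] G, ContDiff ℝ ∞ B ∧ ∀ x z, f (x, z) - f (x, 0) = B (x, z) z := by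
  have hg : ContDiff ℝ ∞ fun p => (fderiv ℝ f p).comp (ContinuousLinearMap.inr ℝ E F) :=
    (hf.fderiv_right (m := ∞) (by simp)).clm_comp contDiff_const
  let g : C(E × F, F →L[ℝ] G) := ⟨_, hg.continuous⟩
  -- `B(x, z)` is the integral of `∂f/∂z (x, t z)` over `[0, 1]`; the sign reverses the integration
  -- from `1` to `0`.
  refine ⟨fun p => -(integrateFromOne _ (g.comp (segmentMap E F p)) 0), ?_, fun x z => ?_⟩
  · exact ((ContinuousMap.evalCLM ℝ (0 : I)).contDiff.comp ((integrateFromOne _).contDiff.comp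
      ((ContinuousMap.contDiff_infty_comp_left g hg).comp (segmentMap E F).contDiff))).neg
  · have h1 : ∀ t : I, HasDerivAt (fun t : ℝ => f (x, t • z))
        (ContinuousMap.pointwiseApply I F G (g.comp (segmentMap E F (x, z)))
          (ContinuousMap.const I z) t) t := by
      intro t
      have h2 : HasDerivAt (fun t : ℝ => (x, t • z)) ((0 : E), z) (t : ℝ) := by
        simpa using (hasDerivAt_const (t : ℝ) x).prodMk ((hasDerivAt_id (t : ℝ)).smul_const z)
      have h5 := ((hf.differentiable (by simp)) (x, (t : ℝ) • z)).hasFDerivAt.comp_hasDerivAt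
        (t : ℝ) h2
      exact h5
    have h3 := integrateFromOne_eq_sub _ _ h1 0
    have h4 : integrateFromOne G (ContinuousMap.pointwiseApply I F G
        (g.comp (segmentMap E F (x, z))) (ContinuousMap.const I z)) 0 =
        integrateFromOne _ (g.comp (segmentMap E F (x, z))) 0 z := by
      rw [integrateFromOne_apply, integrateFromOne_apply,
        ContinuousLinearMap.intervalIntegral_apply]
      · rfl
      · exact (ContinuousMap.continuous _ |>.comp continuous_projIcc).intervalIntegrable _ _
    rw [neg_apply, ← h4, h3]
    simp

end Hadamard

/-! ### Frobenius' theorem for a graph distribution -/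

namespace Frobenius

open unitInterval

variable {E F : Type} [NormedAddCommGroup E] [NormedSpace ℝ E]
  [NormedAddCommGroup F] [NormedSpace ℝ F]

/-- The curve `t ↦ ((c t, t z), z)` along which the total differential equation is integrated. -/
noncomputable def rayMap (E F : Type) [NormedAddCommGroup E] [NormedSpace ℝ E]
    [NormedAddCommGroup F] [NormedSpace ℝ F] : C(I, E) × F →L[ℝ] C(I, (E × F) × F) :=
  LinearMap.mkContinuous
    { toFun := fun p => ⟨fun t => ((p.1 t, (t : ℝ) • p.2), p.2), by fun_prop⟩
      map_add' := fun p q => by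
        ext t
        · rfl
        · exact smul_add _ _ _
        · rfl
      map_smul' := fun c p => by
        ext t
        · rfl
        · exact smul_comm _ _ _
        · rfl } 1
    (fun p => by
      rw [one_mul]
      refine (ContinuousMap.norm_le _ (norm_nonneg p)).2 fun t => ?_
      refine max_le (max_le ((p.1.norm_coe_le_norm t).trans (norm_fst_le p))
        ((norm_smul_le (t : ℝ) p.2).trans ?_)) (norm_snd_le p)
      rw [Real.norm_eq_abs, abs_of_nonneg t.2.1]
      exact (mul_le_of_le_one_left (norm_nonneg _) t.2.2).trans (norm_snd_le p))

lemma rayMap_apply (p : C(I, E) × F) (t : I) :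
    rayMap E F p t = ((p.1 t, (t : ℝ) • p.2), p.2) := rfl

variable {G : E × F → F →L[ℝ] E}

/-- `(x, z) ↦ G(x) z`. -/
def rhs (hG : ContDiff ℝ ∞ G) : C((E × F) × F, E) :=
  ⟨fun q => G q.1 q.2, (hG.continuous.comp continuous_fst).clm_apply continuous_snd⟩

lemma contDiff_rhs (hG : ContDiff ℝ ∞ G) : ContDiff ℝ ∞ (rhs hG) :=
  (hG.comp contDiff_fst).clm_apply contDiff_snd

/-- The derivative of `(x, z) ↦ G(x) z`. -/
noncomputable def rhsDeriv (hG : ContDiff ℝ ∞ G) : C((E × F) × F, (E × F) × F →L[ℝ] E) :=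
  ⟨fderiv ℝ (rhs hG), (contDiff_rhs hG).continuous_fderiv (by simp)⟩

lemma hasFDerivAt_rhs (hG : ContDiff ℝ ∞ G) (q : (E × F) × F) :
    HasFDerivAt (rhs hG) (rhsDeriv hG q) q :=
  ((contDiff_rhs hG).differentiable (by simp) q).hasFDerivAt

lemma rhsDeriv_apply (hG : ContDiff ℝ ∞ G) (q v : (E × F) × F) :
    rhsDeriv hG q v = fderiv ℝ G q.1 v.1 q.2 + G q.1 v.2 := by
  have h1 : HasFDerivAt (fun q : (E × F) × F => G q.1)
      ((fderiv ℝ G q.1).comp (ContinuousLinearMap.fst ℝ (E × F) F)) q :=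
    ((hG.differentiable (by simp)) q.1).hasFDerivAt.comp q hasFDerivAt_fst
  have h2 := h1.clm_apply (hasFDerivAt_snd (𝕜 := ℝ) (p := q))
  have h3 := (hasFDerivAt_rhs hG q).unique h2
  rw [h3]
  simp [add_comm]

/-- The operator `(c, z) ↦ ∫₁ᵗ G(c(τ), τ z) z dτ`. -/
noncomputable def integralOp (hG : ContDiff ℝ ∞ G) (p : C(I, E) × F) : C(I, E) :=
  integrateFromOne E ((rhs hG).comp (rayMap E F p))

/-- The derivative of `integralOp`. -/
noncomputable def integralOpDeriv (hG : ContDiff ℝ ∞ G) (p : C(I, E) × F) :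
    C(I, E) × F →L[ℝ] C(I, E) :=
  (integrateFromOne E).comp ((ContinuousMap.pointwiseApply I _ E
    ((rhsDeriv hG).comp (rayMap E F p))).comp (rayMap E F))

lemma contDiff_integralOp (hG : ContDiff ℝ ∞ G) : ContDiff ℝ ∞ (integralOp hG) :=
  (integrateFromOne E).contDiff.comp ((ContinuousMap.contDiff_infty_comp_left _
    (contDiff_rhs hG)).comp (rayMap E F).contDiff)

lemma hasFDerivAt_integralOp (hG : ContDiff ℝ ∞ G) (p : C(I, E) × F) :
    HasFDerivAt (integralOp hG) (integralOpDeriv hG p) p :=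
  (integrateFromOne E).hasFDerivAt.comp p
    ((ContinuousMap.hasFDerivAt_comp_left (rhs hG) (rhsDeriv hG) (hasFDerivAt_rhs hG)
      (rayMap E F p)).comp p (rayMap E F).hasFDerivAt)

lemma continuous_integralOpDeriv (hG : ContDiff ℝ ∞ G) : Continuous (integralOpDeriv hG) := by
  have : integralOpDeriv hG = fderiv ℝ (integralOp hG) :=
    funext fun p => (hasFDerivAt_integralOp hG p).fderiv.symm
  rw [this]
  exact (contDiff_integralOp hG).continuous_fderiv (by simp)

lemma integralOp_zero_right (hG : ContDiff ℝ ∞ G) (c : C(I, E)) : integralOp hG (c, 0) = 0 := by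
  have : (rhs hG).comp (rayMap E F (c, 0)) = 0 := by
    ext t
    exact map_zero (G _)
  rw [integralOp, this, map_zero]

/-- At the zero curve every term of the linearization carries the factor `z = 0` or `G 0 = 0`. This
makes the linearized fixed point problem the identity at the origin. -/
lemma integralOpDeriv_zero (hG : ContDiff ℝ ∞ G) (h0 : G 0 = 0) : integralOpDeriv hG 0 = 0 := by
  have : (rhsDeriv hG).comp (rayMap E F 0) = 0 := by
    ext t v
    · simp [rhsDeriv_apply]
    · simp [rhsDeriv_apply]
    · simp [rhsDeriv_apply, h0]
  rw [integralOpDeriv, this, map_zero, ContinuousLinearMap.zero_comp, ContinuousLinearMap.comp_zero]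

/-- The variation `t ↦ t G(c(t), t z) w` of a solution `c` satisfies the linearized equation as soon
as `G` is integrable along the solution. -/
lemma variation_eq [CompleteSpace E] (hG : ContDiff ℝ ∞ G) {c : C(I, E)} {y : E} {z w : F}
    (hc : c = ContinuousMap.const I y + integralOp hG (c, z))
    (hint : ∀ t : I, fderiv ℝ G (c t, (t : ℝ) • z) (G (c t, (t : ℝ) • z) z, z) w =
      fderiv ℝ G (c t, (t : ℝ) • z) (G (c t, (t : ℝ) • z) w, w) z)
    {m : C(I, E)} (hm : ∀ t : I, m t = (t : ℝ) • G (c t, (t : ℝ) • z) w) :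
    m = ContinuousMap.const I (G (y, z) w) + integralOpDeriv hG (c, z) (m, w) := by
  set f : C(I, E) := (rhs hG).comp (rayMap E F (c, z))
  -- An extension of `c` to the whole line, so that two-sided derivatives exist at the endpoints of
  -- the interval as well.
  let ĉ : ℝ → E := fun t => y + ∫ τ in (1 : ℝ)..t, f (projIcc 0 1 zero_le_one τ)
  have hĉ : ∀ t : I, ĉ t = c t := fun t => by
    conv_rhs => rw [hc]
    rfl
  have hĉ1 : ĉ 1 = y := by simp [ĉ]
  have hd : ∀ t : I, HasDerivAt ĉ (G (c t, (t : ℝ) • z) z) t := fun t => by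
    have := (hasDerivAt_integral_projIcc f t).const_add y
    rwa [projIcc_val] at this
  let mh : ℝ → E := fun t => t • G (ĉ t, t • z) w
  have hmh : ∀ t : I, HasDerivAt mh (ContinuousMap.pointwiseApply I _ E
      ((rhsDeriv hG).comp (rayMap E F (c, z))) (rayMap E F (m, w)) t) t := fun t => by
    have h1 : HasDerivAt (fun t : ℝ => (ĉ t, t • z)) (G (c t, (t : ℝ) • z) z, z) (t : ℝ) := by
      simpa using (hd t).prodMk ((hasDerivAt_id (t : ℝ)).smul_const z)
    have h2 : HasDerivAt (fun t : ℝ => G (ĉ t, t • z))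
        (fderiv ℝ G (ĉ t, (t : ℝ) • z) (G (c t, (t : ℝ) • z) z, z)) (t : ℝ) :=
      HasFDerivAt.comp_hasDerivAt (f := fun t : ℝ => (ĉ t, t • z)) (t : ℝ)
        ((hG.differentiable (by simp)) (ĉ t, (t : ℝ) • z)).hasFDerivAt h1
    have h3 := (hasDerivAt_id (t : ℝ)).smul (h2.clm_apply (hasDerivAt_const (t : ℝ) w))
    refine h3.congr_deriv ?_
    rw [ContinuousMap.pointwiseApply_apply, ContinuousMap.comp_apply, rhsDeriv_apply,
      rayMap_apply, rayMap_apply]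
    -- The product rule gives `G w + t DG(G z, z) w`. Integrability exchanges `z` and `w`, and the
    -- factor `t` is absorbed into the direction `(m t, t w)`.
    have h4 : ((m t, (t : ℝ) • w) : E × F) = (t : ℝ) • (G (c t, (t : ℝ) • z) w, w) := by
      rw [hm]; rfl
    simp only [h4, map_smul, smul_apply, hĉ, id, map_zero,
      add_zero, one_smul, hint]
  ext t
  have := integrateFromOne_eq_sub _ mh hmh t
  simp only [mh, hĉ1, hĉ, one_smul, ← hm] at this
  simp only [ContinuousMap.add_apply, ContinuousMap.const_apply, integralOpDeriv,
    ContinuousLinearMap.comp_apply, this]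
  abel

/-- **Frobenius' theorem** for the distribution `{(G(x) w, w)}` on `E × F`: if it is integrable, it
is annihilated by the differential of a submersion `φ` onto `E`. -/
theorem exists_submersion [CompleteSpace E] [CompleteSpace F] (hG : ContDiff ℝ ∞ G) (h0 : G 0 = 0)
    (hint : ∀ᶠ x in 𝓝 (0 : E × F), ∀ w z, fderiv ℝ G x (G x z, z) w = fderiv ℝ G x (G x w, w) z) :
    ∃ (φ : E × F → E) (O : Set (E × F)), IsOpen O ∧ 0 ∈ O ∧ ContDiffOn ℝ ∞ φ O ∧
      (∀ y, fderiv ℝ φ 0 (y, 0) = y) ∧ ∀ x ∈ O, ∀ w, fderiv ℝ φ x (G x w, w) = 0 := by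
  -- `Ψ(c, z) = (const y, z)` says that `c' = G(c, t z) z` with `c(1) = y`: the curve over the ray
  -- that ends at `(y, z)`.
  let Ψ : C(I, E) × F → C(I, E) × F := fun p => (p.1 - integralOp hG p, p.2)
  have hΨ : ContDiff ℝ ∞ Ψ := (contDiff_fst.sub (contDiff_integralOp hG)).prodMk contDiff_snd
  have hΨ' : (fderiv ℝ Ψ 0).IsInvertible := by
    have h1 : HasFDerivAt Ψ ((ContinuousLinearMap.fst ℝ C(I, E) F - integralOpDeriv hG 0).prod
        (ContinuousLinearMap.snd ℝ C(I, E) F)) 0 :=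
      (hasFDerivAt_fst.sub (hasFDerivAt_integralOp hG 0)).prodMk hasFDerivAt_snd
    rw [h1.fderiv, integralOpDeriv_zero hG h0]
    refine ⟨ContinuousLinearEquiv.refl ℝ _, ?_⟩
    ext p <;> simp
  obtain ⟨e, he, h0e, -, hsymm, -⟩ := exists_openPartialHomeomorph_contDiffOn isOpen_univ
    (mem_univ 0) hΨ.contDiffOn hΨ'
  let j : E × F →L[ℝ] C(I, E) × F :=
    (ContinuousLinearMap.const ℝ I).prodMap (ContinuousLinearMap.id ℝ F)
  have hΨ0 : Ψ 0 = 0 := Prod.ext (by simpa [Ψ] using! integralOp_zero_right hG 0) rfl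
  have hT : IsOpen (j ⁻¹' e.target) := e.open_target.preimage j.continuous
  have h0T : (0 : E × F) ∈ j ⁻¹' e.target := by
    have := e.map_source h0e
    rw [he, hΨ0] at this
    simpa using this
  let S : E × F → C(I, E) := fun p => (e.symm (j p)).1
  have hS : ContDiffOn ℝ ∞ S (j ⁻¹' e.target) :=
    (hsymm.comp j.contDiff.contDiffOn fun _ h => h).fst
  have hSeq : ∀ p ∈ j ⁻¹' e.target,
      S p = ContinuousMap.const I p.1 + integralOp hG (S p, p.2) := fun p hp => by
    have h1 := e.right_inv hp
    rw [he] at h1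
    have h2 : (e.symm (j p)).2 = p.2 := congrArg Prod.snd h1
    have h3 := congrArg Prod.fst h1
    have h4 : (S p, p.2) = e.symm (j p) := Prod.ext rfl h2.symm
    rw [h4]
    exact sub_eq_iff_eq_add.1 h3
  have hS0 : S 0 = 0 := by
    have h1 := e.left_inv h0e
    rw [he, hΨ0] at h1
    simp [S, h1]
  have hScont : ContinuousAt (fun p : E × F => (S p, p.2)) 0 :=
    ((hS.contDiffAt (hT.mem_nhds h0T)).continuousAt).prodMk continuousAt_snd
  let ev : C(I, E) →L[ℝ] E := ContinuousMap.evalCLM ℝ (0 : I)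
  have hval : ∀ p ∈ j ⁻¹' e.target, HasFDerivAt (fun p => S p 0)
      (ev.comp (fderiv ℝ S p)) p := fun p hp =>
    ev.hasFDerivAt.comp p
      ((hS.contDiffAt (hT.mem_nhds hp)).differentiableAt (by simp)).hasFDerivAt
  have hflat : ∀ᶠ p in 𝓝 (0 : E × F), ∀ w, fderiv ℝ (fun p => S p 0) p (G p w, w) = 0 := by
    obtain ⟨δ, hδ, hball⟩ := Metric.eventually_nhds_iff_ball.1 hint
    -- The first bound keeps the whole ray where integrability holds; the second makes solutions of
    -- the linearized equation unique.
    have hsmall : ∀ᶠ p in 𝓝 (0 : E × F), (S p, p.2) ∈ Metric.ball 0 δ ∧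
        ‖integralOpDeriv hG (S p, p.2)‖ < 1 := by
      have h00 : ((S 0, (0 : E × F).2) : C(I, E) × F) = 0 := by rw [hS0]; rfl
      have hD : Continuous fun q => ‖integralOpDeriv hG q‖ :=
        (continuous_norm (E := C(I, E) × F →L[ℝ] C(I, E))).comp (continuous_integralOpDeriv hG)
      refine (hScont.eventually_mem ?_).and
        (ContinuousAt.eventually_lt (f := fun p : E × F => ‖integralOpDeriv hG (S p, p.2)‖)
          (g := fun _ => 1)
          (ContinuousAt.comp (g := fun q => ‖integralOpDeriv hG q‖) hD.continuousAt hScont)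
          continuousAt_const ?_)
      · rw [h00]
        exact Metric.ball_mem_nhds _ hδ
      · change ‖integralOpDeriv hG (S 0, (0 : E × F).2)‖ < 1
        rw [h00, integralOpDeriv_zero hG h0]
        exact (norm_zero (E := C(I, E) × F →L[ℝ] C(I, E))).trans_lt one_pos
    filter_upwards [hsmall, hT.mem_nhds h0T] with p hp hpT w
    obtain ⟨hp1, hp2⟩ := hp
    set c := S p
    set η := fderiv ℝ S p (G p w, w)
    -- Both `η`, the derivative of the solution in the leaf direction, and the explicit `m` below
    -- solve the same linear equation, so they agree; and `m` vanishes at `t = 0`.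
    have hηeq : η = ContinuousMap.const I (G p w) + integralOpDeriv hG (c, p.2) (η, w) := by
      have hSd := ((hS.contDiffAt (hT.mem_nhds hpT)).differentiableAt (by simp)).hasFDerivAt
      have h1 : HasFDerivAt (fun p : E × F => ContinuousMap.const I p.1 +
          integralOp hG (S p, p.2))
          ((ContinuousLinearMap.const ℝ I).comp (ContinuousLinearMap.fst ℝ E F) +
            (integralOpDeriv hG (S p, p.2)).comp
              ((fderiv ℝ S p).prod (ContinuousLinearMap.snd ℝ E F))) p :=
        ((ContinuousLinearMap.const ℝ I).hasFDerivAt.comp p hasFDerivAt_fst).add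
          ((hasFDerivAt_integralOp hG (S p, p.2)).comp p (hSd.prodMk hasFDerivAt_snd))
      have h2 := h1.congr_of_eventuallyEq (f₁ := S)
        (Filter.eventuallyEq_of_mem (hT.mem_nhds hpT) hSeq)
      have h3 := congrArg (fun L => L (G p w, w)) (hSd.unique h2)
      exact h3
    let m : C(I, E) := ⟨fun t => (t : ℝ) • G (c t, (t : ℝ) • p.2) w, by
      have := hG.continuous
      fun_prop⟩
    have hmeq : m = ContinuousMap.const I (G p w) + integralOpDeriv hG (c, p.2) (m, w) := by
      refine variation_eq hG (hSeq p hpT) (fun t => hball _ ?_ w p.2) (fun t => rfl)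
      have h1 : ‖rayMap E F (c, p.2) t‖ ≤ ‖(c, p.2)‖ := by
        refine ((rayMap E F (c, p.2)).norm_coe_le_norm t).trans ?_
        simpa using (rayMap E F).le_of_opNorm_le
          (LinearMap.mkContinuous_norm_le _ zero_le_one _) (c, p.2)
      rw [mem_ball_zero_iff] at hp1 ⊢
      exact ((norm_fst_le _).trans h1).trans_lt hp1
    have hdiff : η - m = integralOpDeriv hG (c, p.2) (η - m, 0) := by
      conv_lhs => rw [hηeq, hmeq]
      rw [add_sub_add_left_eq_sub, ← map_sub]
      simp
    have hzero : η - m = 0 := by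
      by_contra hne
      have h1 : ‖η - m‖ ≤ ‖integralOpDeriv hG (c, p.2)‖ * ‖η - m‖ := by
        conv_lhs => rw [hdiff]
        refine (ContinuousLinearMap.le_opNorm _ _).trans (le_of_eq ?_)
        simp [Prod.norm_def]
      nlinarith [norm_pos_iff.2 hne]
    rw [(hval p hpT).fderiv]
    change η 0 = 0
    rw [sub_eq_zero.1 hzero]
    exact zero_smul ℝ _
  obtain ⟨O, hO, hOopen, h0O⟩ := eventually_nhds_iff.1 hflat
  refine ⟨fun p => S p 0, O ∩ j ⁻¹' e.target, hOopen.inter hT, ⟨h0O, h0T⟩,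
    ev.contDiff.comp_contDiffOn (hS.mono inter_subset_right),
    fun y => ?_, fun x hx => hO x hx.1⟩
  have h1 : HasFDerivAt (fun y : E => S (y, 0) 0)
      ((fderiv ℝ (fun p => S p 0) 0).comp (ContinuousLinearMap.inl ℝ E F)) 0 :=
    HasFDerivAt.comp (f := fun y : E => (y, (0 : F))) 0
      (hval 0 h0T).differentiableAt.hasFDerivAt (hasFDerivAt_prodMk_left 0 0)
  -- For `z = 0` the ray is a point and the solution is constant.
  have h2 : (fun y : E => S (y, 0) 0) =ᶠ[𝓝 0] id := by
    have : Continuous fun y : E => (y, (0 : F)) := by fun_prop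
    filter_upwards [(hT.preimage this).mem_nhds h0T] with y hy
    change S (y, 0) 0 = y
    rw [hSeq _ hy, integralOp_zero_right, add_zero]
    rfl
  have h3 := h1.unique ((hasFDerivAt_id (0 : E)).congr_of_eventuallyEq h2)
  exact congrArg (fun L => L y) h3

end Frobenius

/-! ### Jets and the first order differential array -/

namespace DAE

section Jets

variable {V W : Type} [NormedAddCommGroup V] [NormedSpace ℝ V]
  [NormedAddCommGroup W] [NormedSpace ℝ W]

lemma hasDerivAt_jet_line (p : ℕ → V) (i : ℕ) :
    HasDerivAt (fun t : ℝ => p i + t • p (i + 1)) (p (i + 1)) 0 := by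
  simpa using ((hasDerivAt_id (0 : ℝ)).smul_const (p (i + 1))).const_add (p i)

lemma hasDerivAt_comp_jet_line {f : V → W} {p : ℕ → V} (hf : DifferentiableAt ℝ f (p 0)) :
    HasDerivAt (fun t : ℝ => f (p 0 + t • p 1)) (fderiv ℝ f (p 0) (p 1)) 0 := by
  have hf' : HasFDerivAt f (fderiv ℝ f (p 0)) (p 0 + (0 : ℝ) • p 1) := by
    simpa using hf.hasFDerivAt
  exact hf'.comp_hasDerivAt (0 : ℝ) (hasDerivAt_jet_line p 0)

variable (Ξ : DAE V) {p : ℕ → V}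

lemma differentiableAt_E {x : V} (hx : x ∈ Ξ.X) : DifferentiableAt ℝ Ξ.E x :=
  (Ξ.smooth_E.contDiffAt (Ξ.isOpen_X.mem_nhds hx)).differentiableAt (by simp)

lemma differentiableAt_F {x : V} (hx : x ∈ Ξ.X) : DifferentiableAt ℝ Ξ.F x :=
  (Ξ.smooth_F.contDiffAt (Ξ.isOpen_X.mem_nhds hx)).differentiableAt (by simp)

lemma hasDerivAt_residual (hp : p 0 ∈ Ξ.X) :
    HasDerivAt (fun t : ℝ => Ξ.E (p 0 + t • p 1) (p 1 + t • p 2) - Ξ.F (p 0 + t • p 1))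
      (fderiv ℝ Ξ.E (p 0) (p 1) (p 1) + Ξ.E (p 0) (p 2) - fderiv ℝ Ξ.F (p 0) (p 1)) 0 := by
  have := ((hasDerivAt_comp_jet_line (Ξ.differentiableAt_E hp)).clm_apply
    (hasDerivAt_jet_line p 1)).sub (hasDerivAt_comp_jet_line (Ξ.differentiableAt_F hp))
  exact this.congr_deriv (by simp)

lemma arrayBlock_one (hp : p 0 ∈ Ξ.X) : Ξ.arrayBlock 1 p =
    fderiv ℝ Ξ.E (p 0) (p 1) (p 1) + Ξ.E (p 0) (p 2) - fderiv ℝ Ξ.F (p 0) (p 1) :=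
  (Ξ.hasDerivAt_residual hp).deriv

lemma solvesArray_zero_iff : Ξ.SolvesArray 0 p ↔ Ξ.E (p 0) (p 1) = Ξ.F (p 0) := by
  simp [SolvesArray, arrayBlock, residual, sub_eq_zero]

lemma solvesArray_one_iff : Ξ.SolvesArray 1 p ↔
    Ξ.E (p 0) (p 1) = Ξ.F (p 0) ∧ Ξ.arrayBlock 1 p = 0 := by
  rw [← solvesArray_zero_iff]
  refine ⟨fun h => ⟨fun j hj => h j (hj.trans zero_le_one), h 1 le_rfl⟩, fun h j hj => ?_⟩
  interval_cases j
  · exact h.1 0 le_rfl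
  · exact h.2

/-- A family of operators annihilating the range of `E` turns the first derivative of the array into
the derivative of a hidden constraint. -/
lemma apply_arrayBlock_one (hp : p 0 ∈ Ξ.X) {P : V → V →L[ℝ] W} (hP : DifferentiableAt ℝ P (p 0))
    (hPE : ∀ᶠ x in 𝓝 (p 0), ∀ v, P x (Ξ.E x v) = 0) (h0 : Ξ.E (p 0) (p 1) = Ξ.F (p 0)) :
    P (p 0) (Ξ.arrayBlock 1 p) = -fderiv ℝ (fun x => P x (Ξ.F x)) (p 0) (p 1) := by
  have h1 := (hasDerivAt_comp_jet_line hP).clm_apply (Ξ.hasDerivAt_residual hp)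
  have h2 := (hasDerivAt_comp_jet_line (hP.clm_apply (Ξ.differentiableAt_F hp))).neg
  have hcont : Filter.Tendsto (fun t : ℝ => p 0 + t • p 1) (𝓝 0) (𝓝 (p 0)) := by
    simpa using (hasDerivAt_jet_line p 0).continuousAt.tendsto
  have h3 := h1.unique (h2.congr_of_eventuallyEq
    ((hcont.eventually hPE).mono fun t ht => by
      change P _ (_ - _) = -(P _ _)
      rw [map_sub, ht, zero_sub]))
  -- The product rule also yields a derivative of `P` applied to the residual, which vanishes by
  -- `h0`.
  rw [Ξ.arrayBlock_one hp, ← h3]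
  simp [h0]

end Jets

/-! ### Row compressions and the hidden constraint -/

section RowCompression

variable {n r s : ℕ} {Ξ : DAE (RSpace n)} {U : Set (RSpace n)}
  {Q : RSpace n → RSpace n →L[ℝ] RSpace r × RSpace s} {x : RSpace n}

/-- The first block `E₁` of `Q E = (E₁, 0)`. -/
noncomputable def differentialPart (Ξ : DAE (RSpace n))
    (Q : RSpace n → RSpace n →L[ℝ] RSpace r × RSpace s) (x : RSpace n) :
    RSpace n →L[ℝ] RSpace r :=
  (ContinuousLinearMap.fst ℝ _ _).comp ((Q x).comp (Ξ.E x))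

namespace IsRowCompression

lemma injective (hQ : Ξ.IsRowCompression U Q) (hx : x ∈ U) : Function.Injective (Q x) := by
  obtain ⟨e, he⟩ := (hQ.2 x hx).1
  rw [← he]
  exact e.injective

lemma apply_E (hQ : Ξ.IsRowCompression U Q) (hx : x ∈ U) (v : RSpace n) :
    Q x (Ξ.E x v) = (Ξ.differentialPart Q x v, 0) :=
  Prod.ext rfl ((hQ.2 x hx).2.1 v)

lemma E_apply_eq_zero_iff (hQ : Ξ.IsRowCompression U Q) (hx : x ∈ U) (v : RSpace n) :
    Ξ.E x v = 0 ↔ Ξ.differentialPart Q x v = 0 := by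
  rw [← map_eq_zero_iff _ (hQ.injective hx), hQ.apply_E hx]
  simp

lemma contDiffOn_differentialPart (hQ : Ξ.IsRowCompression U Q) (hUX : U ⊆ Ξ.X) :
    ContDiffOn ℝ ∞ (Ξ.differentialPart Q) U :=
  contDiffOn_const.clm_comp (hQ.1.clm_comp (Ξ.smooth_E.mono hUX))

lemma contDiffOn_algebraicPart (hQ : Ξ.IsRowCompression U Q) (hUX : U ⊆ Ξ.X) :
    ContDiffOn ℝ ∞ (Ξ.algebraicPart Q) U :=
  (hQ.1.clm_apply (Ξ.smooth_F.mono hUX)).snd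

lemma exists_apply_E_eq (hQ : Ξ.IsRowCompression U Q) (hx : x ∈ U)
    (h0 : Ξ.algebraicPart Q x = 0) : ∃ v, Ξ.E x v = Ξ.F x := by
  obtain ⟨v, hv⟩ := (hQ.2 x hx).2.2 (Q x (Ξ.F x)).1
  exact ⟨v, hQ.injective hx (Prod.ext hv (((hQ.2 x hx).2.1 v).trans h0.symm))⟩

/-- The first order array can be solved at `(x, x')` exactly if `x'` satisfies the DAE and the
hidden constraint. -/
lemma exists_solvesArray_one_iff (hQ : Ξ.IsRowCompression U Q) (hU : IsOpen U) (hUX : U ⊆ Ξ.X)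
    (hx : x ∈ U) (x' : RSpace n) :
    (∃ p : ℕ → RSpace n, p 0 = x ∧ p 1 = x' ∧ Ξ.SolvesArray 1 p) ↔
      Ξ.E x x' = Ξ.F x ∧ fderiv ℝ (Ξ.algebraicPart Q) x x' = 0 := by
  let P : RSpace n → RSpace n →L[ℝ] RSpace s := fun x => (ContinuousLinearMap.snd ℝ _ _).comp (Q x)
  have hP : DifferentiableAt ℝ P x :=
    (differentiableAt_const _).clm_comp
      ((hQ.1.contDiffAt (hU.mem_nhds hx)).differentiableAt (by simp))
  have hPE : ∀ᶠ y in 𝓝 x, ∀ v, P y (Ξ.E y v) = 0 :=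
    Filter.eventually_of_mem (hU.mem_nhds hx) fun y hy v => (hQ.2 y hy).2.1 v
  constructor
  · rintro ⟨p, rfl, rfl, hp⟩
    rw [solvesArray_one_iff] at hp
    have h1 := Ξ.apply_arrayBlock_one (hUX hx) hP hPE hp.1
    rw [hp.2, map_zero] at h1
    exact ⟨hp.1, neg_eq_zero.1 h1.symm⟩
  · rintro ⟨h1, h2⟩
    -- Surjectivity of `E₁` lets `x''` cancel the first block; the second block does not depend on
    -- `x''` and vanishes by the hidden constraint.
    obtain ⟨x'', hx''⟩ := (hQ.2 x hx).2.2
      (-(Q x (fderiv ℝ Ξ.E x x' x' - fderiv ℝ Ξ.F x x')).1)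
    let p : ℕ → RSpace n := fun i => if i = 0 then x else if i = 1 then x' else x''
    refine ⟨p, rfl, rfl, Ξ.solvesArray_one_iff.2 ⟨h1, hQ.injective hx ?_⟩⟩
    rw [map_zero]
    refine Prod.ext ?_ ?_
    · rw [Ξ.arrayBlock_one (p := p) (hUX hx), add_sub_right_comm, map_add, Prod.fst_add]
      exact (congrArg₂ (· + ·) rfl hx'').trans (add_neg_cancel _)
    · exact (Ξ.apply_arrayBlock_one (p := p) (hUX hx) hP hPE h1).trans (neg_eq_zero.2 h2)

end IsRowCompression

end RowCompression

end DAE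

/-! ### Invertible derivatives and Lie brackets -/

section FiniteDimensional

variable {V W : Type} [NormedAddCommGroup V] [NormedSpace ℝ V]
  [NormedAddCommGroup W] [NormedSpace ℝ W]

lemma ContinuousLinearMap.isInvertible_of_injective [FiniteDimensional ℝ V] [FiniteDimensional ℝ W]
    (hd : Module.finrank ℝ V = Module.finrank ℝ W) {L : V →L[ℝ] W} (hL : Function.Injective L) :
    L.IsInvertible :=
  ⟨(LinearEquiv.ofInjectiveOfFinrankEq (L : V →ₗ[ℝ] W) hL hd).toContinuousLinearEquiv,
    by ext; rfl⟩

lemma OpenPartialHomeomorph.isInvertible_fderiv (e : OpenPartialHomeomorph V W)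
    (he : DifferentiableOn ℝ e e.source) (he' : DifferentiableOn ℝ e.symm e.target)
    {x : V} (hx : x ∈ e.source) : (fderiv ℝ e x).IsInvertible := by
  have h1 := (he.differentiableAt (e.open_source.mem_nhds hx)).hasFDerivAt
  have h2 := (he'.differentiableAt (e.open_target.mem_nhds (e.map_source hx))).hasFDerivAt
  have h1' : HasFDerivAt e (fderiv ℝ e x) (e.symm (e x)) := by rwa [e.left_inv hx]
  have h3 := (h2.comp x h1).unique
    ((hasFDerivAt_id x).congr_of_eventuallyEq (e.eventually_left_inverse hx))
  have h4 := (h1'.comp (e x) h2).unique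
    ((hasFDerivAt_id (e x)).congr_of_eventuallyEq (e.eventually_right_inverse (e.map_source hx)))
  exact ⟨ContinuousLinearEquiv.equivOfInverse _ _ (fun v => congrArg (fun L => L v) h3)
    (fun v => congrArg (fun L => L v) h4), rfl⟩

/-- If `g` and `h` are annihilated by `Dφ`, then so is their Lie bracket. -/
lemma fderiv_lieBracket_eq_zero {φ : V → W} {g h : V → V} {x : V} (hφ : ContDiffAt ℝ ∞ φ x)
    (hg : DifferentiableAt ℝ g x) (hh : DifferentiableAt ℝ h x)
    (hφg : ∀ᶠ y in 𝓝 x, fderiv ℝ φ y (g y) = 0) (hφh : ∀ᶠ y in 𝓝 x, fderiv ℝ φ y (h y) = 0) :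
    fderiv ℝ φ x (VectorField.lieBracket ℝ g h x) = 0 := by
  have hd : DifferentiableAt ℝ (fderiv ℝ φ) x :=
    (hφ.fderiv_right (m := 1) (by norm_cast)).differentiableAt (by simp)
  -- Differentiating `Dφ(k) = 0` trades `Dk` for the second derivative of `φ`, whose symmetry then
  -- cancels the bracket.
  have key : ∀ {k : V → V}, DifferentiableAt ℝ k x → (∀ᶠ y in 𝓝 x, fderiv ℝ φ y (k y) = 0) →
      ∀ v, fderiv ℝ φ x (fderiv ℝ k x v) = -fderiv ℝ (fderiv ℝ φ) x v (k x) := by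
    intro k hk hφk v
    have h1 := (hd.hasFDerivAt.clm_apply hk.hasFDerivAt).unique
      ((hasFDerivAt_const (0 : W) x).congr_of_eventuallyEq hφk)
    have h2 := congrArg (fun L => L v) h1
    exact eq_neg_of_add_eq_zero_left (by simpa using h2)
  have hsymm : IsSymmSndFDerivAt ℝ φ x := hφ.isSymmSndFDerivAt (by
    rw [minSmoothness_of_isRCLikeNormedField]
    exact WithTop.coe_le_coe.2 (le_top : (2 : ℕ∞) ≤ ⊤))
  rw [VectorField.lieBracket, map_sub, key hg hφg, key hh hφh, hsymm.eq (g x) (h x), sub_self]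

end FiniteDimensional

/-! ### Characterization of index one -/

namespace DAE

/-- No regularity is asked of `v`, so it can be chosen pointwise as soon as `x'` is unique; where no
solution exists its value is arbitrary. -/
lemma arrayDetermines_iff {V : Type} [NormedAddCommGroup V] [NormedSpace ℝ V] (Ξ : DAE V) (xp : V)
    (k : ℕ) : Ξ.ArrayDetermines xp k ↔ (∃ p : ℕ → V, p 0 = xp ∧ Ξ.SolvesArray k p) ∧
      ∃ W : Set V, IsOpen W ∧ xp ∈ W ∧ W ⊆ Ξ.X ∧ ∀ p q : ℕ → V, p 0 ∈ W → p 0 = q 0 →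
        Ξ.SolvesArray k p → Ξ.SolvesArray k q → p 1 = q 1 := by
  refine and_congr_right fun _ => exists_congr fun W => and_congr_right fun _ =>
    and_congr_right fun _ => and_congr_right fun _ => ⟨?_, fun h => ?_⟩
  · rintro ⟨v, hv⟩ p q hp hpq hsp hsq
    rw [hv p hp hsp, hv q (hpq ▸ hp) hsq, hpq]
  · classical
    refine ⟨fun x => if hx : ∃ q : ℕ → V, q 0 = x ∧ Ξ.SolvesArray k q then hx.choose 1 else 0,
      fun p hp hsp => ?_⟩
    have hx : ∃ q : ℕ → V, q 0 = p 0 ∧ Ξ.SolvesArray k q := ⟨p, rfl, hsp⟩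
    simp only [dif_pos hx]
    exact h p _ hp hx.choose_spec.1.symm hsp hx.choose_spec.2

section Index

variable {n r s : ℕ} {Ξ : DAE (RSpace n)} {U : Set (RSpace n)}
  {Q : RSpace n → RSpace n →L[ℝ] RSpace r × RSpace s} {x : RSpace n}

/-- The operator `(E₁, DF₂)`. -/
noncomputable def extendedMap (Ξ : DAE (RSpace n))
    (Q : RSpace n → RSpace n →L[ℝ] RSpace r × RSpace s) (x : RSpace n) :
    RSpace n →L[ℝ] RSpace r × RSpace s :=
  (Ξ.differentialPart Q x).prod (fderiv ℝ (Ξ.algebraicPart Q) x)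

lemma extendedMap_apply (v : RSpace n) : Ξ.extendedMap Q x v =
    (Ξ.differentialPart Q x v, fderiv ℝ (Ξ.algebraicPart Q) x v) := rfl

namespace IsRowCompression

lemma contDiffOn_extendedMap (hQ : Ξ.IsRowCompression U Q) (hU : IsOpen U) (hUX : U ⊆ Ξ.X) :
    ContDiffOn ℝ ∞ (Ξ.extendedMap Q) U := by
  have h1 := hQ.contDiffOn_differentialPart hUX
  have h2 : ContDiffOn ℝ ∞ (fderiv ℝ (Ξ.algebraicPart Q)) U :=
    (hQ.contDiffOn_algebraicPart hUX).fderiv_of_isOpen hU (by simp)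
  have h3 : Ξ.extendedMap Q = fun x =>
      (ContinuousLinearMap.inl ℝ _ _).comp (Ξ.differentialPart Q x) +
        (ContinuousLinearMap.inr ℝ _ _).comp (fderiv ℝ (Ξ.algebraicPart Q) x) := by
    funext x
    ext1 v
    simp [extendedMap_apply]
  rw [h3]
  exact (contDiffOn_const.clm_comp h1).add (contDiffOn_const.clm_comp h2)

lemma isOpen_isInvertible_extendedMap (hQ : Ξ.IsRowCompression U Q) (hU : IsOpen U)
    (hUX : U ⊆ Ξ.X) : IsOpen {x ∈ U | (Ξ.extendedMap Q x).IsInvertible} :=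
  (hQ.contDiffOn_extendedMap hU hUX).continuousOn.isOpen_inter_preimage hU
    ContinuousLinearEquiv.isOpen

/-- Without a second block the square operator `E` is onto. The order zero array then already fixes
`x'`, which excludes index one. -/
lemma injective_E_of_eq_zero (hQ : Ξ.IsRowCompression U Q) (hx : x ∈ U) (hs : s = 0) :
    Function.Injective (Ξ.E x) := by
  have hsurj : Function.Surjective (Ξ.E x).toLinearMap := fun y => by
    obtain ⟨v, hv⟩ := (hQ.2 x hx).2.2 (Q x y).1
    subst hs
    exact ⟨v, hQ.injective hx (Prod.ext hv (Subsingleton.elim _ _))⟩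
  exact LinearMap.injective_iff_surjective.2 hsurj

lemma not_injective_E (hQ : Ξ.IsRowCompression U Q) (hx : x ∈ U) (hs : 0 < s) :
    ¬Function.Injective (Ξ.E x) := fun hinj => by
  have hsurj : Function.Surjective (Ξ.E x).toLinearMap :=
    LinearMap.injective_iff_surjective.1 hinj
  have : Nonempty (Fin s) := ⟨⟨0, hs⟩⟩
  obtain ⟨z, hz⟩ := exists_ne (0 : RSpace s)
  obtain ⟨y, hy⟩ := (hQ.2 x hx).1.surjective (0, z)
  obtain ⟨v, hv⟩ := hsurj y
  have h1 := (hQ.2 x hx).2.1 v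
  have h2 : Ξ.E x v = y := hv
  rw [h2, hy] at h1
  exact hz h1

/-- The index is one exactly if there are algebraic constraints and `(E₁, DF₂)` is invertible. -/
theorem hasIndex_one_iff (hQ : Ξ.IsRowCompression U Q) (hU : IsOpen U) (hUX : U ⊆ Ξ.X)
    (hx : x ∈ U) (hrs : r + s = n) (h0 : Ξ.algebraicPart Q x = 0) :
    Ξ.HasIndex x 1 ↔ 0 < s ∧ (Ξ.extendedMap Q x).IsInvertible := by
  have hjet := fun {y} (hy : y ∈ U) x' => hQ.exists_solvesArray_one_iff hU hUX hy x'
  constructor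
  · rintro ⟨hdet, hleast⟩
    obtain ⟨⟨p, hp0, hp⟩, W, hW, hxW, hWX, hWv⟩ := (Ξ.arrayDetermines_iff x 1).1 hdet
    refine ⟨Nat.pos_of_ne_zero fun hs => ?_, ?_⟩
    · refine absurd (hleast (show 0 ∈ {k | Ξ.ArrayDetermines x k} from ?_)) (by norm_num)
      refine (Ξ.arrayDetermines_iff x 0).2 ⟨⟨p, hp0, fun j hj => hp j (hj.trans zero_le_one)⟩,
        U, hU, hx, hUX, fun p q hpU hpq hsp hsq => ?_⟩
      rw [solvesArray_zero_iff] at hsp hsq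
      refine hQ.injective_E_of_eq_zero hpU hs ?_
      rw [hsp, hpq, hsq]
    · refine ContinuousLinearMap.isInvertible_of_injective (by simp [hrs]) ?_
      rw [injective_iff_map_eq_zero]
      -- A kernel vector `k` of `(E₁, DF₂)` can be added to `x'` without leaving the solution set of
      -- the first order array.
      intro k hk
      obtain ⟨hk1, hk2⟩ := Prod.ext_iff.1 hk
      have h1 := (hjet hx (p 1)).1 ⟨p, hp0, rfl, hp⟩
      obtain ⟨q, hq0, hq1, hq⟩ := (hjet hx (p 1 + k)).2
        ⟨by rw [map_add, h1.1, (hQ.E_apply_eq_zero_iff hx k).2 hk1, add_zero],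
          by rw [map_add, h1.2, zero_add]; exact hk2⟩
      have h2 := hWv p q (hp0 ▸ hxW) (hp0.trans hq0.symm) hp hq
      rw [hq1] at h2
      exact left_eq_add.1 h2
  · rintro ⟨hs, hinv⟩
    obtain ⟨v, hv⟩ := hinv.surjective ((Q x (Ξ.F x)).1, 0)
    obtain ⟨hv1, hv2⟩ := Prod.ext_iff.1 hv
    have hEv : Ξ.E x v = Ξ.F x :=
      hQ.injective hx (Prod.ext hv1 (((hQ.2 x hx).2.1 v).trans h0.symm))
    obtain ⟨p, hp0, hp1, hp⟩ := (hjet hx v).2 ⟨hEv, hv2⟩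
    refine ⟨(Ξ.arrayDetermines_iff x 1).2 ⟨⟨p, hp0, hp⟩, _,
      hQ.isOpen_isInvertible_extendedMap hU hUX, ⟨hx, hinv⟩, fun y hy => hUX hy.1,
      fun p q hpU hpq hsp hsq => ?_⟩, fun k hk => Nat.one_le_iff_ne_zero.2 ?_⟩
    · have h1 := (hjet hpU.1 (p 1)).1 ⟨p, rfl, rfl, hsp⟩
      have h2 := (hjet hpU.1 (q 1)).1 ⟨q, hpq.symm, rfl, hsq⟩
      have h3 : Ξ.differentialPart Q (p 0) (p 1 - q 1) = 0 := by
        rw [← hQ.E_apply_eq_zero_iff hpU.1, map_sub, h1.1, h2.1, sub_self]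
      refine sub_eq_zero.1 (hpU.2.injective ?_)
      rw [map_zero, extendedMap_apply, h3, map_sub, h1.2, h2.2, sub_self]
      rfl
    · rintro rfl
      obtain ⟨-, W, -, hxW, -, hWv⟩ := (Ξ.arrayDetermines_iff x 0).1 hk
      refine hQ.not_injective_E hx hs ((injective_iff_map_eq_zero _).2 fun k hk0 => ?_)
      -- If `E` is injective on no account of constraints, order zero would suffice; here a kernel
      -- vector `k` of `E` is added to `v`. Entries beyond `q 1` do not enter at order zero.
      let q : ℕ → RSpace n := fun i => if i = 0 then x else v + k
      have hq : Ξ.SolvesArray 0 q := by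
        rw [solvesArray_zero_iff]
        change Ξ.E x (v + k) = Ξ.F x
        rw [map_add, hk0, add_zero, hEv]
      have h2 : p 1 = v + k := hWv p q (hp0 ▸ hxW) hp0
        (fun j hj => hp j (hj.trans zero_le_one)) hq
      rw [hp1] at h2
      exact left_eq_add.1 h2

end IsRowCompression

end Index

/-! ### From the normal form to index one and involutivity -/

section ToNormalForm

variable {n r s : ℕ} {Ξ : DAE (RSpace n)}

/-- The data of an external equivalence to a normal form: a row compression which is at the same
time the splitting of a diffeomorphism. -/
lemma ExEquivalentOn.exists_isRowCompression {Ξ' : DAE (RSpace r × RSpace s)} {V : Set (RSpace n)}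
    (hV : IsOpen V) (hinwf : Ξ'.IsINWF) (heq : Ξ.ExEquivalentOn Ξ' V) :
    ∃ (Q : RSpace n → RSpace n →L[ℝ] RSpace r × RSpace s) (ψ : RSpace n → RSpace r × RSpace s),
      Ξ.IsRowCompression V Q ∧ ContDiffOn ℝ ∞ ψ V ∧ (∀ x ∈ V, (fderiv ℝ ψ x).IsInvertible) ∧
      ∀ x ∈ V, Ξ.extendedMap Q x = fderiv ℝ ψ x := by
  obtain ⟨-, X₁, X₂, Fs, -, -, -, -, hform⟩ := hinwf
  obtain ⟨-, ψ, Q, rfl, hψX, hψ, hψ', hQ, hQinv, hEF⟩ := heq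
  have hinv : ∀ x ∈ ψ.source, (fderiv ℝ ψ x).IsInvertible := fun x hx =>
    ψ.isInvertible_fderiv (hψ.differentiableOn (by simp)) (hψ'.differentiableOn (by simp)) hx
  have hQE : ∀ x ∈ ψ.source, ∀ v, Q x (Ξ.E x v) = ((fderiv ℝ ψ x v).1, 0) := fun x hx v => by
    rw [← (hform _ (hψX (ψ.map_source hx))).1, (hEF x hx).1]
    obtain ⟨e, he⟩ := hinv x hx
    simp [← he]
  have halg : ∀ x ∈ ψ.source, Ξ.algebraicPart Q x = (ψ x).2 := fun x hx => by
    rw [algebraicPart, ← (hEF x hx).2, (hform _ (hψX (ψ.map_source hx))).2]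
  refine ⟨Q, ψ, ⟨hQ, fun x hx => ⟨hQinv x hx, fun v => by rw [hQE x hx], fun y => ?_⟩⟩, hψ, hinv,
    fun x hx => ?_⟩
  · obtain ⟨v, hv⟩ := (hinv x hx).surjective (y, 0)
    exact ⟨v, by simp [hQE x hx, hv]⟩
  · have h1 : HasFDerivAt (fun x => (ψ x).2) _ x :=
      ((hψ.contDiffAt (hV.mem_nhds hx)).differentiableAt (by simp)).hasFDerivAt.snd
    have h2 := (h1.congr_of_eventuallyEq
      (Filter.eventuallyEq_of_mem (hV.mem_nhds hx) halg)).fderiv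
    ext1 v
    rw [extendedMap_apply, h2]
    exact Prod.ext (congrArg (fun q => q.1) (hQE x hx v)) rfl

/-- The block `E₁` is the differential of the first component of `ψ`, and kernels of differentials
are closed under brackets. -/
lemma kerInvolutiveOn_of_extendedMap_eq_fderiv {V : Set (RSpace n)} (hV : IsOpen V)
    {Q : RSpace n → RSpace n →L[ℝ] RSpace r × RSpace s} {ψ : RSpace n → RSpace r × RSpace s}
    (hQ : Ξ.IsRowCompression V Q) (hψ : ContDiffOn ℝ ∞ ψ V)
    (heq : ∀ x ∈ V, Ξ.extendedMap Q x = fderiv ℝ ψ x) : Ξ.KerInvolutiveOn V := by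
  have hfst : ∀ x ∈ V, fderiv ℝ (fun y => (ψ y).1) x = Ξ.differentialPart Q x := fun x hx => by
    have h1 := ((hψ.contDiffAt (hV.mem_nhds hx)).differentiableAt (by simp)).hasFDerivAt.fst
    rw [h1.fderiv, ← heq x hx]
    rfl
  have hE : ∀ x ∈ V, ∀ v, Ξ.E x v = 0 ↔ fderiv ℝ (fun y => (ψ y).1) x v = 0 := fun x hx v => by
    rw [hfst x hx, hQ.E_apply_eq_zero_iff hx]
  intro W hW hWV g h hg hh hEg hEh x hx
  have hnear := hW.mem_nhds hx
  rw [hE x (hWV hx)]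
  exact fderiv_lieBracket_eq_zero (hψ.contDiffAt (hV.mem_nhds (hWV hx))).fst
    ((hg.contDiffAt hnear).differentiableAt (by simp))
    ((hh.contDiffAt hnear).differentiableAt (by simp))
    (Filter.eventually_of_mem hnear fun y hy => (hE y (hWV hy) _).1 (hEg y hy))
    (Filter.eventually_of_mem hnear fun y hy => (hE y (hWV hy) _).1 (hEh y hy))

end ToNormalForm

end DAE

/-! ### Straightening an involutive kernel -/

/-- Frobenius' theorem around `a` for the kernel of a family of surjections `A(x) : V → E`: it is
the kernel of the differential of a map `φ` with `Dφ(a) = A(a)`. -/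
lemma exists_fderiv_eq_zero_of_involutive {V E F : Type} [NormedAddCommGroup V] [NormedSpace ℝ V]
    [FiniteDimensional ℝ V] [NormedAddCommGroup E] [NormedSpace ℝ E] [CompleteSpace E]
    [NormedAddCommGroup F] [NormedSpace ℝ F] [CompleteSpace F] {A : V → V →L[ℝ] E} {U : Set V}
    {a : V} (hU : IsOpen U) (ha : a ∈ U) (hA : ContDiffOn ℝ ∞ A U) (L : V ≃L[ℝ] E × F)
    (hL : ∀ v, (L v).1 = A a v)
    (hinv : ∀ W ⊆ U, IsOpen W → ∀ g h : V → V, ContDiffOn ℝ ∞ g W → ContDiffOn ℝ ∞ h W →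
      (∀ x ∈ W, A x (g x) = 0) → (∀ x ∈ W, A x (h x) = 0) →
      ∀ x ∈ W, A x (VectorField.lieBracket ℝ g h x) = 0) :
    ∃ (φ : V → E) (O : Set V), IsOpen O ∧ a ∈ O ∧ O ⊆ U ∧ ContDiffOn ℝ ∞ φ O ∧
      (∀ v, fderiv ℝ φ a v = A a v) ∧ ∀ x ∈ O, ∀ v, A x v = 0 → fderiv ℝ φ x v = 0 := by
  -- In the splitting `L` the operator `A(a)` is the first projection. Near `a` the block `A₁` stays
  -- invertible, and `ker A` is the graph of `-A₁⁻¹ A₂`.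
  let A₁ : V → E →L[ℝ] E := fun x =>
    ((A x).comp (L.symm : E × F →L[ℝ] V)).comp (ContinuousLinearMap.inl ℝ E F)
  let A₂ : V → F →L[ℝ] E := fun x =>
    ((A x).comp (L.symm : E × F →L[ℝ] V)).comp (ContinuousLinearMap.inr ℝ E F)
  have hA₁ : ContDiffOn ℝ ∞ A₁ U := (hA.clm_comp contDiffOn_const).clm_comp contDiffOn_const
  have hA₂ : ContDiffOn ℝ ∞ A₂ U := (hA.clm_comp contDiffOn_const).clm_comp contDiffOn_const
  have hsplit : ∀ x y w, A x (L.symm (y, w)) = A₁ x y + A₂ x w := fun x y w => by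
    have : ((y, w) : E × F) = (y, 0) + (0, w) := by simp
    rw [this, map_add, map_add]
    rfl
  have hA₁a : A₁ a = ContinuousLinearMap.id ℝ E := by
    ext y
    change A a (L.symm (y, 0)) = y
    rw [← hL, L.apply_symm_apply]
  have hA₂a : A₂ a = 0 := by
    ext w
    change A a (L.symm (0, w)) = 0
    rw [← hL, L.apply_symm_apply]
  set O₁ : Set V := {x ∈ U | (A₁ x).IsInvertible}
  have hO₁ : IsOpen O₁ :=
    hA₁.continuousOn.isOpen_inter_preimage hU ContinuousLinearEquiv.isOpen
  have haO₁ : a ∈ O₁ := ⟨ha, ContinuousLinearEquiv.refl ℝ E, hA₁a.symm⟩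
  have hslope : ContDiffOn ℝ ∞ (fun x => -((A₁ x).inverse.comp (A₂ x))) O₁ := fun x hx =>
    ((hx.2.contDiffAt_map_inverse.comp_contDiffWithinAt x
      (hA₁.mono inter_subset_left x hx)).clm_comp (hA₂.mono inter_subset_left x hx)).neg
  obtain ⟨G, hG, hGeq⟩ := exists_contDiff_eventuallyEq hO₁ haO₁ hslope
  obtain ⟨O₂, hO₂eq, hO₂, haO₂⟩ := eventually_nhds_iff.1 hGeq
  replace hO₂eq : ∀ x ∈ O₂, G x = -((A₁ x).inverse.comp (A₂ x)) := hO₂eq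
  set O := O₁ ∩ O₂
  have hO : IsOpen O := hO₁.inter hO₂
  have haO : a ∈ O := ⟨haO₁, haO₂⟩
  have hGa : G a = 0 := by rw [hO₂eq a haO₂, hA₂a, ContinuousLinearMap.comp_zero, neg_zero]
  have hA₁G : ∀ x ∈ O, ∀ w, A₁ x (G x w) = -A₂ x w := fun x hx w => by
    obtain ⟨e, he⟩ := hx.1.2
    rw [hO₂eq x hx.2, ← he]
    simp
  have hsec : ∀ x ∈ O, ∀ w, A x (L.symm (G x w, w)) = 0 := fun x hx w => by
    rw [hsplit, hA₁G x hx, neg_add_cancel]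
  have hker : ∀ x ∈ O, ∀ v, A x v = 0 → L v = (G x (L v).2, (L v).2) := fun x hx v hv => by
    refine Prod.ext (hx.1.2.injective ?_) rfl
    rw [hA₁G x hx, eq_neg_iff_add_eq_zero, ← hsplit, Prod.mk.eta, L.symm_apply_apply, hv]
  -- For constant `w` these sections frame the kernel. Their brackets have no `F` component, so
  -- involutivity becomes the symmetry condition on `DG`.
  let section' : F → V → V := fun w x => L.symm (G x w, w)
  have hsection : ∀ w, ContDiff ℝ ∞ (section' w) := fun w =>
    L.symm.contDiff.comp ((hG.clm_apply contDiff_const).prodMk contDiff_const)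
  have hsection' : ∀ w x v, fderiv ℝ (section' w) x v = L.symm (fderiv ℝ G x v w, 0) :=
    fun w x v => by
    have h1 : HasFDerivAt (section' w) _ x := (L.symm : E × F →L[ℝ] V).hasFDerivAt.comp x
      ((((hG.differentiable (by simp)) x).hasFDerivAt.clm_apply
        (hasFDerivAt_const w x)).prodMk (hasFDerivAt_const w x))
    rw [h1.fderiv]
    simp
  have hintegrable : ∀ x ∈ O, ∀ w z,
      fderiv ℝ G x (section' z x) w = fderiv ℝ G x (section' w x) z := fun x hx w z => by
    have h1 := hinv O (fun y hy => hy.1.1) hO (section' z) (section' w) (hsection z).contDiffOn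
      (hsection w).contDiffOn (fun y hy => hsec y hy z) (fun y hy => hsec y hy w) x hx
    rw [VectorField.lieBracket, hsection', hsection', ← map_sub, Prod.mk_sub_mk, sub_zero,
      hsplit, map_zero, add_zero] at h1
    exact sub_eq_zero.1 (hx.1.2.injective (h1.trans (map_zero _).symm))
  let τ : E × F → V := fun q => a + L.symm q
  let σ : V → E × F := fun x => L (x - a)
  have hσ : ContDiff ℝ ∞ σ := L.contDiff.comp (contDiff_id.sub contDiff_const)
  have hτ : ContDiff ℝ ∞ τ := contDiff_const.add L.symm.contDiff
  have hτσ : ∀ x, τ (σ x) = x := fun x => by simp [τ, σ]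
  have hσa : σ a = 0 := by simp [σ]
  have hτ0 : τ 0 = a := by simp [τ]
  have hGτ : ∀ q v, fderiv ℝ (fun q => G (τ q)) q v = fderiv ℝ G (τ q) (L.symm v) := fun q v => by
    have h1 : HasFDerivAt τ (L.symm : E × F →L[ℝ] V) q := L.symm.hasFDerivAt.const_add a
    have h2 : HasFDerivAt (fun q => G (τ q)) _ q :=
      ((hG.differentiable (by simp)) (τ q)).hasFDerivAt.comp q h1
    rw [h2.fderiv]
    rfl
  obtain ⟨φ, N, hN, h0N, hφ, hφ0, hφN⟩ := Frobenius.exists_submersion (G := fun q => G (τ q))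
    (hG.comp hτ) (by rw [hτ0, hGa]) (by
      have h1 : τ ⁻¹' O ∈ 𝓝 0 := (hO.preimage hτ.continuous).mem_nhds (by rwa [mem_preimage, hτ0])
      filter_upwards [h1] with q hq w z
      rw [hGτ, hGτ]
      exact hintegrable _ hq w z)
  have hφσ : ∀ x ∈ σ ⁻¹' N, ∀ v, fderiv ℝ (fun x => φ (σ x)) x v = fderiv ℝ φ (σ x) (L v) :=
    fun x hx v => by
    have h1 : HasFDerivAt σ (L : V →L[ℝ] E × F) x :=
      HasFDerivAt.comp (g := L) (f := fun x => x - a) x L.hasFDerivAt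
        ((hasFDerivAt_id x).sub_const a)
    have h2 : HasFDerivAt (fun x => φ (σ x)) _ x :=
      ((hφ.contDiffAt (hN.mem_nhds hx)).differentiableAt (by simp)).hasFDerivAt.comp x h1
    rw [h2.fderiv]
    rfl
  have haN : a ∈ σ ⁻¹' N := by rwa [mem_preimage, hσa]
  refine ⟨fun x => φ (σ x), O ∩ σ ⁻¹' N, hO.inter (hN.preimage hσ.continuous), ⟨haO, haN⟩,
    fun x hx => hx.1.1.1, hφ.comp hσ.contDiffOn fun x hx => hx.2, fun v => ?_,
    fun x hx v hv => ?_⟩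
  · have h1 := hφN 0 h0N (L v).2
    rw [hτ0, hGa, zero_apply] at h1
    have h2 : L v = ((L v).1, 0) + (0, (L v).2) := by simp
    rw [hφσ a haN, hσa, h2, map_add, hφ0, h1, add_zero, hL]
  · rw [hφσ x hx.2, hker x hx.1 v hv]
    have h1 := hφN (σ x) hx.2 (L v).2
    rwa [hτσ] at h1

/-! ### Construction of the normal form -/

/-- The shear `(a, b) ↦ (a - B b, b)`. -/
noncomputable def shear {E F : Type} [NormedAddCommGroup E] [NormedSpace ℝ E]
    [NormedAddCommGroup F] [NormedSpace ℝ F] (B : F →L[ℝ] E) : E × F →L[ℝ] E × F :=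
  ContinuousLinearMap.id ℝ (E × F) - (ContinuousLinearMap.inl ℝ E F).comp
    (B.comp (ContinuousLinearMap.snd ℝ E F))

section Shear

variable {E F : Type} [NormedAddCommGroup E] [NormedSpace ℝ E]
  [NormedAddCommGroup F] [NormedSpace ℝ F]

lemma shear_apply (B : F →L[ℝ] E) (p : E × F) : shear B p = (p.1 - B p.2, p.2) := by
  ext <;> simp [shear]

lemma isInvertible_shear (B : F →L[ℝ] E) : (shear B).IsInvertible :=
  ⟨ContinuousLinearEquiv.equivOfInverse (shear B) (shear (-B))
    (fun p => by simp [shear_apply]) (fun p => by simp [shear_apply]), rfl⟩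

lemma contDiffOn_shear {V : Type} [NormedAddCommGroup V] [NormedSpace ℝ V] {B : V → F →L[ℝ] E}
    {U : Set V} (hB : ContDiffOn ℝ ∞ B U) : ContDiffOn ℝ ∞ (fun x => shear (B x)) U :=
  contDiffOn_const.sub (contDiffOn_const.clm_comp (hB.clm_comp contDiffOn_const))

end Shear

namespace DAE

/-- The index-1 nonlinear Weierstrass form with vector field `Fs`. -/
noncomputable def normalForm {r : ℕ} (s : ℕ) (Fs : RSpace r → RSpace r) (hFs : ContDiff ℝ ∞ Fs) :
    DAE (RSpace r × RSpace s) where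
  X := univ
  isOpen_X := isOpen_univ
  E := fun _ => (ContinuousLinearMap.inl ℝ _ _).comp (ContinuousLinearMap.fst ℝ _ _)
  F := fun ξ => (Fs ξ.1, ξ.2)
  smooth_E := contDiffOn_const
  smooth_F := ((hFs.comp contDiff_fst).prodMk contDiff_snd).contDiffOn

lemma isINWF_normalForm {r s : ℕ} (hs : 0 < s) (Fs : RSpace r → RSpace r) (hFs : ContDiff ℝ ∞ Fs) :
    (normalForm s Fs hFs).IsINWF :=
  ⟨hs, univ, univ, Fs, isOpen_univ, isOpen_univ, hFs.contDiffOn, univ_prod_univ.symm,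
    fun _ _ => ⟨fun _ => rfl, rfl⟩⟩

variable {n r s : ℕ} {Ξ : DAE (RSpace n)} {U : Set (RSpace n)}
  {Q : RSpace n → RSpace n →L[ℝ] RSpace r × RSpace s} {x₀ : RSpace n}

/-- Straightening `ker E` and using the constraint `F₂` as the remaining coordinates yields the
normal form. -/
theorem IsRowCompression.exists_exEquivalentOn_normalForm (hQ : Ξ.IsRowCompression U Q)
    (hU : IsOpen U) (hUX : U ⊆ Ξ.X) (hx₀ : x₀ ∈ U) (hM : (Ξ.extendedMap Q x₀).IsInvertible)
    (hker : Ξ.KerInvolutiveAt x₀) :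
    ∃ V : Set (RSpace n), IsOpen V ∧ x₀ ∈ V ∧ V ⊆ U ∧
      ∃ (Fs : RSpace r → RSpace r) (hFs : ContDiff ℝ ∞ Fs),
        Ξ.ExEquivalentOn (normalForm s Fs hFs) V := by
  obtain ⟨W, hW, hxW, -, hinv⟩ := hker
  obtain ⟨L, hL⟩ := hM
  have hLv : ∀ v, L v = Ξ.extendedMap Q x₀ v := fun v => congrArg (fun T => T v) hL
  obtain ⟨φ, O, hO, hxO, hOU, hφ, hφ₀, hφker⟩ := exists_fderiv_eq_zero_of_involutive
    (hU.inter hW) ⟨hx₀, hxW⟩ ((hQ.contDiffOn_differentialPart hUX).mono inter_subset_left) L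
    (fun v => by rw [hLv]; rfl)
    (fun W' hW' hW'o g h hg hh hEg hEh x hx => by
      have hE := fun {y} (hy : y ∈ W') v => hQ.E_apply_eq_zero_iff (hW' hy).1 v
      rw [← hE hx]
      exact hinv W' hW'o (fun y hy => (hW' hy).2) g h hg hh
        (fun y hy => (hE hy _).2 (hEg y hy)) (fun y hy => (hE hy _).2 (hEh y hy)) x hx)
  set M := Ξ.extendedMap Q
  set O₁ : Set (RSpace n) := O ∩ {x ∈ U | (M x).IsInvertible}
  have hO₁ : IsOpen O₁ := hO.inter (hQ.isOpen_isInvertible_extendedMap hU hUX)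
  have hxO₁ : x₀ ∈ O₁ := ⟨hxO, hx₀, L, hL⟩
  have hO₁U : O₁ ⊆ U := fun x hx => hx.2.1
  let ψ : RSpace n → RSpace r × RSpace s := fun x => (φ x, Ξ.algebraicPart Q x)
  have halg := (hQ.contDiffOn_algebraicPart hUX).mono hO₁U
  have hψ : ContDiffOn ℝ ∞ ψ O₁ := (hφ.mono inter_subset_left).prodMk halg
  have hψ' : ∀ x ∈ O₁, ∀ v, fderiv ℝ ψ x v = (fderiv ℝ φ x v, (M x v).2) := fun x hx v => by
    have h1 := ((hφ.contDiffAt (hO.mem_nhds hx.1)).differentiableAt (by simp)).hasFDerivAt.prodMk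
      ((halg.contDiffAt (hO₁.mem_nhds hx)).differentiableAt (by simp)).hasFDerivAt
    rw [h1.fderiv]
    rfl
  have hψ₀ : (fderiv ℝ ψ x₀).IsInvertible := ⟨L, by
    ext1 v
    rw [hψ' x₀ hxO₁, hφ₀]
    exact hLv v⟩
  obtain ⟨e, he, hxe, heO, hesymm, heinv⟩ :=
    exists_openPartialHomeomorph_contDiffOn hO₁ hxO₁ hψ hψ₀
  -- Since `Dφ` vanishes on `ker E₁`, the operator `Dψ M⁻¹` is block diagonal with second block the
  -- identity: it replaces `E₁` by `Dφ` and keeps `F₂`.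
  let N : RSpace n → RSpace n →L[ℝ] RSpace r × RSpace s := fun x =>
    (fderiv ℝ ψ x).comp ((M x).inverse.comp (Q x))
  have hN : ContDiffOn ℝ ∞ N O₁ := by
    have h1 : ContDiffOn ℝ ∞ (fun x => (M x).inverse) O₁ := fun x hx =>
      hx.2.2.contDiffAt_map_inverse.comp_contDiffWithinAt x
        ((hQ.contDiffOn_extendedMap hU hUX).mono hO₁U x hx)
    exact (hψ.fderiv_of_isOpen hO₁ (by simp)).clm_comp (h1.clm_comp (hQ.1.mono hO₁U))
  -- the action of `N` in terms of a preimage under `M`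
  have hNapply : ∀ x ∈ O₁, ∀ y, ∃ m, M x m = Q x y ∧ N x y = (fderiv ℝ φ x m, (M x m).2) :=
    fun x hx y => by
    obtain ⟨T, hT⟩ := hx.2.2
    refine ⟨(M x).inverse (Q x y), ?_, hψ' x hx _⟩
    rw [← hT, ContinuousLinearMap.inverse_equiv]
    exact T.apply_symm_apply _
  have hNE : ∀ x ∈ O₁, ∀ v, N x (Ξ.E x v) = ((fderiv ℝ ψ x v).1, 0) := fun x hx v => by
    obtain ⟨m, hm, hNm⟩ := hNapply x hx (Ξ.E x v)
    rw [hQ.apply_E (hO₁U hx)] at hm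
    have h1 : Ξ.differentialPart Q x (m - v) = 0 := by
      rw [map_sub, sub_eq_zero]
      exact congrArg (fun q => q.1) hm
    have h2 := hφker x hx.1 _ h1
    rw [map_sub, sub_eq_zero] at h2
    rw [hNm, hm, h2, hψ' x hx]
  have hNF : ∀ x ∈ O₁, (N x (Ξ.F x)).2 = (ψ x).2 := fun x hx => by
    obtain ⟨m, hm, hNm⟩ := hNapply x hx (Ξ.F x)
    rw [hNm, hm]
    rfl
  obtain ⟨f, hf, hfeq⟩ := exists_contDiff_eventuallyEq e.open_target (e.map_source hxe)
    (f := fun ξ => (N (e.symm ξ) (Ξ.F (e.symm ξ))).1)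
    (((hN.clm_apply (Ξ.smooth_F.mono (hO₁U.trans hUX))).fst).comp hesymm
      fun ξ hξ => heO (e.map_target hξ))
  obtain ⟨O₂, hO₂eq, hO₂, hxO₂⟩ := eventually_nhds_iff.1 hfeq
  -- The shear by `B` removes the dependence on `ξ₂`; it leaves `N E` unchanged because the second
  -- block of `N E` is zero.
  obtain ⟨B, hB, hBf⟩ := exists_contDiff_hadamard f hf
  have hV : IsOpen (e.source ∩ e ⁻¹' O₂) := e.isOpen_inter_preimage hO₂
  set V := e.source ∩ e ⁻¹' O₂
  have hVO₁ : V ⊆ O₁ := fun x hx => heO hx.1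
  have hψV := hψ.mono hVO₁
  have hfψ : ∀ x ∈ V, f (ψ x) = (N x (Ξ.F x)).1 := fun x hx => by
    have h1 : f (e x) = (N (e.symm (e x)) (Ξ.F (e.symm (e x)))).1 := hO₂eq _ hx.2
    rw [e.left_inv hx.1, he] at h1
    exact h1
  have hsource : (e.restrOpen V hV).source = V := inter_eq_right.2 inter_subset_left
  have hFs : ContDiff ℝ ∞ fun a => f (a, 0) := hf.comp (contDiff_id.prodMk contDiff_const)
  refine ⟨V, hV, ⟨hxe, hxO₂⟩, hVO₁.trans hO₁U, _, hFs, hVO₁.trans (hO₁U.trans hUX),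
    e.restrOpen V hV, fun x => (shear (B (ψ x))).comp (N x), hsource, subset_univ _, ?_,
    hesymm.mono fun ξ hξ => hξ.1, ?_, fun x hx => ?_, fun x hx => ⟨?_, ?_⟩⟩
  · rw [hsource]
    change ContDiffOn ℝ ∞ e V
    rwa [he]
  · exact (contDiffOn_shear (hB.comp_contDiffOn hψV)).clm_comp (hN.mono hVO₁)
  · exact (isInvertible_shear _).comp ((heinv x hx.1).comp
      ((hVO₁ hx).2.2.inverse.comp (hQ.2 x (hO₁U (hVO₁ hx))).1))
  · change (ContinuousLinearMap.inl ℝ _ _).comp (ContinuousLinearMap.fst ℝ _ _) =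
      ((shear (B (ψ x))).comp (N x)).comp ((Ξ.E x).comp (fderiv ℝ e x).inverse)
    rw [he]
    refine ContinuousLinearMap.ext fun u => ?_
    obtain ⟨T, hT⟩ := heinv x hx.1
    have h1 : fderiv ℝ ψ x ((fderiv ℝ ψ x).inverse u) = u := by
      rw [← hT, ContinuousLinearMap.inverse_equiv]
      exact T.apply_symm_apply u
    simp only [ContinuousLinearMap.comp_apply]
    rw [hNE x (hVO₁ hx), h1, shear_apply]
    simp
  · change (f ((e x).1, 0), (e x).2) = shear (B (ψ x)) (N x (Ξ.F x))
    have h1 := hBf (ψ x).1 (ψ x).2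
    rw [Prod.mk.eta] at h1
    rw [he, shear_apply, hNF x (hVO₁ hx), ← hfψ x hx, ← h1, sub_sub_cancel]

end DAE

/-! ### The equivalence -/

theorem mainTheorem1 (n : ℕ) (Ξ : DAE (RSpace n)) (xp : RSpace n) (hxp : xp ∈ Ξ.X)
    (U : Set (RSpace n)) (hCR : Ξ.ConstantRank xp U) :
    (∃ V : Set (RSpace n), IsOpen V ∧ xp ∈ V ∧ V ⊆ U ∧
      ∃ (r s : ℕ) (Ξ' : DAE (RSpace r × RSpace s)),
        r + s = n ∧ Ξ'.IsINWF ∧ Ξ.ExEquivalentOn Ξ' V) ↔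
    (Ξ.HasIndex xp 1 ∧ Ξ.KerInvolutiveAt xp) := by
  obtain ⟨hU, hxU, hUX, r, s, hrs, -, Q, hQ, h0, -, -⟩ := hCR
  constructor
  · rintro ⟨V, hV, hxV, hVU, r', s', Ξ', hrs', hinwf, heq⟩
    obtain ⟨Q', ψ, hQ', hψ, hψinv, hext⟩ := heq.exists_isRowCompression hV hinwf
    obtain ⟨v, hv⟩ := hQ.exists_apply_E_eq hxU h0
    -- Consistency at `xp` means that `F(xp)` lies in the range of `E(xp)`, a condition independent
    -- of the row compression; so it passes from `Q` to `Q'`.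
    have h0' : Ξ.algebraicPart Q' xp = 0 := by
      rw [DAE.algebraicPart, ← hv, hQ'.apply_E hxV]
    refine ⟨(hQ'.hasIndex_one_iff hV (hVU.trans hUX) hxV hrs' h0').2 ⟨hinwf.1, ?_⟩, V, hV, hxV,
      hVU.trans hUX, DAE.kerInvolutiveOn_of_extendedMap_eq_fderiv hV hQ' hψ hext⟩
    rw [hext xp hxV]
    exact hψinv xp hxV
  · rintro ⟨hindex, hker⟩
    obtain ⟨hs, hM⟩ := (hQ.hasIndex_one_iff hU hUX hxU hrs h0).1 hindex
    obtain ⟨V, hV, hxV, hVU, Fs, hFs, heq⟩ :=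
      hQ.exists_exEquivalentOn_normalForm hU hUX hxU hM hker
    exact ⟨V, hV, hxV, hVU, r, s, _, hrs, DAE.isINWF_normalForm hs Fs hFs, heq⟩
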